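/- Let $\Delta_1,\dots,\Delta_{16}$ be the $16$ reflexive polygons in $\mathbb{Z}^2$ up to $GL(2,\mathbb{Z})$, represented by the polygons with vertices 1: $(-2,-1),(1,-1),(1,2)$; 2: $(-2,-1),(2,-1),(0,1)$; 3: $(-1,-1),(1,-1),(1,2),(-1,0)$; 4: $(-1,-1),(1,-1),(1,1),(-1,1)$; 5: $(-1,-1),(2,-1),(0,1),(-1,0)$; 6: $(-1,-1),(0,-1),(2,1),(0,1),(-1,0)$; 7: $(-2,-1),(1,-1),(0,1)$; 8: $(-1,0),(0,-1),(1,0),(-1,2)$; 9: $(-1,-1),(1,-1),(1,0),(0,1),(-1,0)$; 10: $(-1,-1),(0,-1),(1,0),(1,1),(0,1),(-1,0)$; 11: $(-1,-1),(1,-1),(0,1),(-1,0)$; 12: $(-1,-1),(0,-1),(1,0),(0,1),(-1,0)$; 13: $(-2,-1),(1,0),(0,1)$; 14: $(-1,-1),(1,0),(0,1),(-1,0)$; 15: $(-1,0),(0,-1),(1,0),(0,1)$; 16: $(-1,-1),(1,0),(0,1)$. Let $v_\alpha\in\mathbb{Z}^2$ be the vertices of $\Delta_a$, let $\sigma\subset\mathbb{R}^3$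 be the cone spanned by the vectors $(v_\alpha,1)$, and let $S=\sigma^\vee\cap\mathbb{Z}^3$. Let $x_1,\dots,x_k$ correspond to the Hilbert basis $m_1,\dots,m_k$ of $S$, let $I=\ker(\mathbb{C}[x_1,\dots,x_k]\to\mathbb{C}[S])$, and let $\mathcal{X}_a=\operatorname{Spec}\mathbb{C}[x_1,\dots,x_k]/I$. For $b=(b_\alpha)$ with $b_\alpha>0$ give $x_h$ the weight $q_h(b)=\sum_\alpha b_\alpha\langle m_h,(v_\alpha,1)\rangle$, let $g(t;\mathcal{X}_a,b)$ be the Hilbert series of $\mathbb{C}[x]/I$ for this real grading, and put $V(b)=\frac{8}{27}\lim_{s\to0^+}s^3g(e^{-s};\mathcal{X}_a,b)$. The $U(1)_R$ symmetry $\zeta_R$ is the grading by $R_h=q_h(r)$, where $r$ minimises $V$ among all $b$ with $b_\alpha>0$ and $\sum_\alpha b_\alpha=2$. For a grading $\zeta$ define $A_0,A_1,A_2,A_3$ by the Laurent expansion $$g(e^{-s};\mathcal{X}_a,\zeta)=\frac{2A_0(\zeta)}{s^3}+\frac{A_1(\zeta)}{s^2}+\frac{A_2(\zeta)}{s}+A_3(\zeta)+\cdots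 .$$ For each $h$ let $\eta_h$ be the test symmetry of weight $1$ on $x_h$ and weight $0$ on the other generators, and let $I_0$ be the ideal spanned by the lowest $\eta_h$-weight parts of the elements of $I$. Let $A_i(\zeta+\epsilon\eta_h)$ be the coefficients for the Hilbert series of $\mathbb{C}[x]/I_0$ graded by $\zeta+\epsilon\eta_h$, and put $$F(\mathcal{X}_a;\zeta,\eta_h)=\frac{A_0(\zeta)}{2}\,\frac{d}{d\epsilon}\Big|_{\epsilon=0}\frac{A_1(\zeta+\epsilon\eta_h)}{A_0(\zeta+\epsilon\eta_h)}+\frac{A_1(\zeta)}{6A_0(\zeta)}\,\frac{d}{d\epsilon}\Big|_{\epsilon=0}A_0(\zeta+\epsilon\eta_h).$$ Proposition. For every $a\in\{1,\dots,16\}$ a minimiser $r$ exists, and for every minimiser $r$ all the quantities above are well defined and $$F(\mathcal{X}_a;\zeta_R,\eta_h)\ \ge\ \tfrac38\big(A_2(\zeta_R)-A_3(\zeta_R)\big)\qquad\text{for every generator }x_h\text{ of }\mathcal{X}_a .$$ Equality holds for some generator $x_h$ of $\mathcal{X}_a$ if and only if $a\in\{2,7,13\}$. -/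

import Mathlib

open Filter Topology

noncomputable section

/-- A reflexive lattice polygon, given by its `k + 3` vertices in cyclic order together with the
vertices of its polar dual polygon `{u | u · v ≥ -1 for all v ∈ Δ}`, which are required to be lattice
points. The dual vertex `dual i` cuts out the edge of `Δ` from `vertex i` to `vertex (i + 1)`:
all vertices satisfy `dual i · v ≥ -1`, with equality exactly at the two endpoints of that edge. -/
structure ReflexivePolygon where
  k : ℕ
  vertex : Fin (k + 3) → ℤ × ℤ
  dual : Fin (k + 3) → ℤ × ℤ
  dual_ge : ∀ i j, -1 ≤ (dual i).1 * (vertex j).1 + (dual i).2 * (vertex j).2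
  dual_eq_iff : ∀ i j,
    (dual i).1 * (vertex j).1 + (dual i).2 * (vertex j).2 = -1 ↔ j = i ∨ j = i + 1

/-- The 16 reflexive polygons up to unimodular equivalence, numbered `1, …, 16`
(other indices return the last one and are never used). -/
def model : ℕ → ReflexivePolygon
  | 1 => ⟨0, ![(-2, -1), (1, -1), (1, 2)], ![(0, 1), (-1, 0), (1, -1)], by decide, by decide⟩
  | 2 => ⟨0, ![(-2, -1), (2, -1), (0, 1)], ![(0, 1), (-1, -1), (1, -1)], by decide, by decide⟩
  | 3 => ⟨1, ![(-1, -1), (1, -1), (1, 2), (-1, 0)], ![(0, 1), (-1, 0), (1, -1), (1, 0)],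
      by decide, by decide⟩
  | 4 => ⟨1, ![(-1, -1), (1, -1), (1, 1), (-1, 1)], ![(0, 1), (-1, 0), (0, -1), (1, 0)],
      by decide, by decide⟩
  | 5 => ⟨1, ![(-1, -1), (2, -1), (0, 1), (-1, 0)], ![(0, 1), (-1, -1), (1, -1), (1, 0)],
      by decide, by decide⟩
  | 6 => ⟨2, ![(-1, -1), (0, -1), (2, 1), (0, 1), (-1, 0)],
      ![(0, 1), (-1, 1), (0, -1), (1, -1), (1, 0)], by decide, by decide⟩
  | 7 => ⟨0, ![(-2, -1), (1, -1), (0, 1)], ![(0, 1), (-2, -1), (1, -1)], by decide, by decide⟩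
  | 8 => ⟨1, ![(-1, 0), (0, -1), (1, 0), (-1, 2)], ![(1, 1), (-1, 1), (-1, -1), (1, 0)],
      by decide, by decide⟩
  | 9 => ⟨2, ![(-1, -1), (1, -1), (1, 0), (0, 1), (-1, 0)],
      ![(0, 1), (-1, 0), (-1, -1), (1, -1), (1, 0)], by decide, by decide⟩
  | 10 => ⟨3, ![(-1, -1), (0, -1), (1, 0), (1, 1), (0, 1), (-1, 0)],
      ![(0, 1), (-1, 1), (-1, 0), (0, -1), (1, -1), (1, 0)], by decide, by decide⟩
  | 11 => ⟨1, ![(-1, -1), (1, -1), (0, 1), (-1, 0)], ![(0, 1), (-2, -1), (1, -1), (1, 0)],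
      by decide, by decide⟩
  | 12 => ⟨2, ![(-1, -1), (0, -1), (1, 0), (0, 1), (-1, 0)],
      ![(0, 1), (-1, 1), (-1, -1), (1, -1), (1, 0)], by decide, by decide⟩
  | 13 => ⟨0, ![(-2, -1), (1, 0), (0, 1)], ![(-1, 3), (-1, -1), (1, -1)], by decide, by decide⟩
  | 14 => ⟨1, ![(-1, -1), (1, 0), (0, 1), (-1, 0)], ![(-1, 2), (-1, -1), (1, -1), (1, 0)],
      by decide, by decide⟩
  | 15 => ⟨1, ![(-1, 0), (0, -1), (1, 0), (0, 1)], ![(1, 1), (-1, 1), (-1, -1), (1, -1)],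
      by decide, by decide⟩
  | _ => ⟨0, ![(-1, -1), (1, 0), (0, 1)], ![(-1, 2), (-1, -1), (2, -1)], by decide, by decide⟩

namespace ReflexivePolygon

variable (P : ReflexivePolygon)

/-- The primitive generator `(vertex α, 1)` of a ray of the cone `σ` over the polygon. -/
def ray (α : Fin (P.k + 3)) : Fin 3 → ℤ := ![(P.vertex α).1, (P.vertex α).2, 1]

/-- The semigroup `σ^∨ ∩ ℤ³` of lattice points of the dual cone. -/
def semigroup : AddSubmonoid (Fin 3 → ℤ) where
  carrier := {m | ∀ α, 0 ≤ m ⬝ᵥ P.ray α}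
  zero_mem' := by intro α; simp
  add_mem' := by
    intro a b ha hb α
    rw [add_dotProduct]
    exact add_nonneg (ha α) (hb α)

/-- The generators `x_h` of the toric Calabi-Yau 3-fold: the elements of the Hilbert basis of
`σ^∨ ∩ ℤ³`. -/
def Gen : Type := {m : P.semigroup // AddIrreducible m}

/-- The ideal `I` of relations among the generators: the kernel of `ℂ[x_h] → ℂ[σ^∨ ∩ ℤ³]`, so that
`ℂ[x_h] / I` is the coordinate ring of the toric Calabi-Yau 3-fold. -/
def toricIdeal : Ideal (MvPolynomial P.Gen ℂ) :=
  RingHom.ker (MvPolynomial.aeval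
    (fun h : P.Gen => (AddMonoidAlgebra.single h.1 1 : AddMonoidAlgebra ℂ P.semigroup)) :
      MvPolynomial P.Gen ℂ →ₐ[ℂ] AddMonoidAlgebra ℂ P.semigroup)

/-- The charge `∑_α b_α ⟨h, (vertex α, 1)⟩` of the generator `x_h = ∏_α p_α ^ ⟨h, (vertex α, 1)⟩`
when the field `p_α` attached to the vertex `α` has charge `b_α`. -/
def charge (b : Fin (P.k + 3) → ℝ) (h : P.Gen) : ℝ :=
  ∑ α, b α * (((h.1 : Fin 3 → ℤ) ⬝ᵥ P.ray α : ℤ) : ℝ)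

end ReflexivePolygon

section Hilbert

variable {ι : Type}

/-- The graded piece of degree `i` of `ℂ[x] / J`, for the grading with real weights `w`. -/
def gradedPiece (J : Ideal (MvPolynomial ι ℂ)) (w : ι → ℝ) (i : ℝ) :
    Submodule ℂ (MvPolynomial ι ℂ ⧸ J) :=
  (MvPolynomial.weightedHomogeneousSubmodule ℂ w i).map (Ideal.Quotient.mkₐ ℂ J).toLinearMap

/-- The Hilbert series `∑_i dim (ℂ[x] / J)_i t ^ i` at `t = exp (-s)`. -/
def hilbertSeries (J : Ideal (MvPolynomial ι ℂ)) (w : ι → ℝ) (s : ℝ) : ℝ :=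
  ∑' i : ℝ, (Module.finrank ℂ (gradedPiece J w i) : ℝ) * Real.exp (-(s * i))

/-- The ideal of the central fibre of the test configuration induced by the weights `η`: the flat
limit, spanned by the lowest `η`-weight parts of the elements of `I`. -/
def centralIdeal (I : Ideal (MvPolynomial ι ℂ)) (η : ι → ℕ) : Ideal (MvPolynomial ι ℂ) :=
  Ideal.span {p | ∃ f ∈ I, ∃ n : ℕ, p = MvPolynomial.weightedHomogeneousComponent η n f ∧
    ∀ j < n, MvPolynomial.weightedHomogeneousComponent η j f = 0}

/-- The Hilbert series of the central fibre for the grading `ζ + ε η`, where `q` are the weights of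
the generators under `ζ`. -/
def perturbedSeries (I : Ideal (MvPolynomial ι ℂ)) (q : ι → ℝ) (η : ι → ℕ) (ε : ℝ) : ℝ → ℝ :=
  hilbertSeries (centralIdeal I η) (fun i => q i + ε * (η i : ℝ))

/-- `g s = a₀ / s ^ n + a₁ / s ^ (n - 1) + …`, a Laurent series converging for small `s > 0`. -/
def HasLaurentExpansion (n : ℕ) (g : ℝ → ℝ) (a : ℕ → ℝ) : Prop :=
  ∀ᶠ s in 𝓝[>] (0 : ℝ), HasSum (fun m : ℕ => a m * s ^ ((m : ℤ) - (n : ℤ))) (g s)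

open Classical in
/-- The coefficient `a_m` of the Laurent expansion (unique when it exists; `0` otherwise). -/
def laurentCoeff (n : ℕ) (g : ℝ → ℝ) (m : ℕ) : ℝ :=
  if h : ∃ a, HasLaurentExpansion n g a then h.choose m else 0

/-- The normalised coefficients for `n = 3`: `g = 2 A₀ / s ^ 3 + A₁ / s ^ 2 + A₂ / s + A₃ + …`. -/
def coeffA (g : ℝ → ℝ) (m : ℕ) : ℝ :=
  if m < 3 then laurentCoeff 3 g m / ((3 - m - 1).factorial : ℝ) else laurentCoeff 3 g m

/-- The Futaki invariant in dimension `n = 3`,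
`A₀ / (n - 1) * D_ε [A₁ / A₀] + A₁ / (n (n - 1) A₀) * D_ε A₀` at `ε = 0`. -/
def futaki (I : Ideal (MvPolynomial ι ℂ)) (q : ι → ℝ) (η : ι → ℕ) : ℝ :=
  coeffA (hilbertSeries I q) 0 / 2 *
      deriv (fun ε => coeffA (perturbedSeries I q η ε) 1 / coeffA (perturbedSeries I q η ε) 0) 0 +
    coeffA (hilbertSeries I q) 1 / (6 * coeffA (hilbertSeries I q) 0) *
      deriv (fun ε => coeffA (perturbedSeries I q η ε) 0) 0

/-- Everything that enters the Futaki invariant is defined: the Laurent expansions exist, the leading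
coefficients do not vanish, and the derivatives exist. -/
def FutakiDefined (I : Ideal (MvPolynomial ι ℂ)) (q : ι → ℝ) (η : ι → ℕ) : Prop :=
  (∃ a, HasLaurentExpansion 3 (hilbertSeries I q) a) ∧
  coeffA (hilbertSeries I q) 0 ≠ 0 ∧
  (∀ᶠ ε in 𝓝 (0 : ℝ), (∃ a, HasLaurentExpansion 3 (perturbedSeries I q η ε) a) ∧
    coeffA (perturbedSeries I q η ε) 0 ≠ 0) ∧
  DifferentiableAt ℝ
    (fun ε => coeffA (perturbedSeries I q η ε) 1 / coeffA (perturbedSeries I q η ε) 0) 0 ∧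
  DifferentiableAt ℝ (fun ε => coeffA (perturbedSeries I q η ε) 0) 0

end Hilbert

namespace ReflexivePolygon

variable (P : ReflexivePolygon)

/-- `V` is the normalised volume `(8 / 27) lim_{s → 0} s ^ 3 g(t_α = exp (-s b_α))` of the Sasakian
base for the Reeb vector components `b_α`. -/
def HasVolume (b : Fin (P.k + 3) → ℝ) (V : ℝ) : Prop :=
  Tendsto (fun s : ℝ => 8 / 27 * (s ^ 3 * hilbertSeries P.toricIdeal (P.charge b) s))
    (𝓝[>] 0) (𝓝 V)

/-- `r` are `U(1)_R` charges of the fields `p_α`: they are positive, sum to `2`, and minimise the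
volume under these constraints. -/
def IsRCharge (r : Fin (P.k + 3) → ℝ) : Prop :=
  (∀ α, 0 < r α) ∧ ∑ α, r α = 2 ∧ ∃ V, P.HasVolume r V ∧
    ∀ b : Fin (P.k + 3) → ℝ, (∀ α, 0 < b α) → ∑ α, b α = 2 → ∃ W, P.HasVolume b W ∧ V ≤ W

open Classical in
/-- The test symmetry `η_h`: weight `1` on `x_h` and weight `0` on the other generators. -/
def testSymmetry (h : P.Gen) : P.Gen → ℕ := fun j => if j = h then 1 else 0

/-- The Hilbert series `g(t; 𝒳, ζ_R)` at `t = exp (-s)`. -/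
def seriesR (r : Fin (P.k + 3) → ℝ) : ℝ → ℝ := hilbertSeries P.toricIdeal (P.charge r)

/-- The Futaki invariant `F(𝒳; ζ_R, η_h)`. -/
def futakiR (r : Fin (P.k + 3) → ℝ) (h : P.Gen) : ℝ :=
  futaki P.toricIdeal (P.charge r) (P.testSymmetry h)

end ReflexivePolygon

end

/-! The lattice points of the dual cone split into half-open unimodular cones: consecutive boundary
points `u i`, `u (i + 1)` of the polar polygon form a basis of ℤ², so `(0, 0, 1)`, `(u i, 1)`, `(u
(i + 1), 1)` form a basis of ℤ³. Geometric series then give the Hilbert series g in terms of the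
charges `q i` of the points `(u i, 1)`, and s³ g tends to `vol / 2` with `vol = ∑ 1 / (q i * q (i +
1))`. The Gorenstein symmetry, that e^(-s) s³ g is even in s (`exp_neg_mul_numerator_neg`), forces
A₀ = vol/4, A₁ = vol/2 and A₂ - A₃ = vol/6.

The central fibre has one basis monomial for each semigroup element, represented with the largest
possible exponent of x_h. Splitting the semigroup into its translate by h and the complement shows
that the perturbed series is g (1 - e^(-sq)) / (1 - e^(-s(q+ε))), where q is the charge of x_h
(`perturbedSeries_monoidIdeal`). Hence F = vol/8 - vol/(12 q), and the claimed inequality says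
exactly that q ≥ 4/3.

This bound comes from volume minimisation. The Minkowski relation `sum_mul_vol` writes the Reeb
vector as a positive combination of the rays; differentiating it at a minimiser (`first_variation`)
gives ⟨m, ray⟩ ≤ (3/2) deg m for nonzero m, with equality iff m vanishes on all other rays
(`dotProduct_ray_le`). A generator on the axis of `(0, 0, 1)` has charge at least 2, and any other
pairs to at least 2 with some ray, so q ≥ 4/3. Equality needs an integral affine function equal to 2
at one vertex and 0 at all others, which exists only for polygons 2, 7 and 13. -/

/-! ### Hilbert series from bases of monomials -/

open Classical in
/-- The linear map from polynomials to the free module on `T` that sends a monomial `x ^ a` with `p a`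
to the basis vector `π a` and all other monomials to `0`. -/
noncomputable def markedMap {ι T : Type} (π : (ι →₀ ℕ) → T) (p : (ι →₀ ℕ) → Prop) :
    MvPolynomial ι ℂ →ₗ[ℂ] (T →₀ ℂ) :=
  (MvPolynomial.basisMonomials ι ℂ).constr ℂ
    (fun a => if p a then Finsupp.single (π a) 1 else 0)

open Classical in
theorem markedMap_monomial {ι T : Type} (π : (ι →₀ ℕ) → T) (p : (ι →₀ ℕ) → Prop)
    (a : ι →₀ ℕ) (c : ℂ) :
    markedMap π p (MvPolynomial.monomial a c) = if p a then Finsupp.single (π a) c else 0 := by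
  have h : MvPolynomial.monomial a c = c • MvPolynomial.basisMonomials ι ℂ a := by
    simp [MvPolynomial.smul_monomial]
  rw [h, map_smul, markedMap, Module.Basis.constr_basis]
  split_ifs <;> simp

theorem finrank_map_eq_of_ker_eq {K V W W' : Type*} [Field K] [AddCommGroup V] [Module K V]
    [AddCommGroup W] [Module K W] [AddCommGroup W'] [Module K W'] (f : V →ₗ[K] W) (g : V →ₗ[K] W')
    (h : LinearMap.ker f = LinearMap.ker g) (M : Submodule K V) :
    Module.finrank K (M.map f) = Module.finrank K (M.map g) := by
  rw [← LinearMap.range_domRestrict, ← LinearMap.range_domRestrict]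
  have hk : LinearMap.ker (f.domRestrict M) = LinearMap.ker (g.domRestrict M) := by
    rw [LinearMap.ker_domRestrict, LinearMap.ker_domRestrict, h]
  exact (((f.domRestrict M).quotKerEquivRange.symm.trans (Submodule.quotEquivOfEq _ _ hk)).trans
    (g.domRestrict M).quotKerEquivRange).finrank_eq

/-- The ideal is the kernel of the marked map, so a graded piece has the dimension of its image
there, which is spanned by the basis vectors of weight `i`. -/
theorem finrank_gradedPiece {ι T : Type} {π : (ι →₀ ℕ) → T} {p : (ι →₀ ℕ) → Prop}
    {J : Ideal (MvPolynomial ι ℂ)} (hJ : ∀ f, f ∈ J ↔ markedMap π p f = 0)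
    (hsurj : ∀ t, ∃ a, p a ∧ π a = t) {w : ι → ℝ} {W : T → ℝ}
    (hw : ∀ a, p a → Finsupp.weight w a = W (π a)) (i : ℝ) [Finite {t // W t = i}] :
    Module.finrank ℂ (gradedPiece J w i) = Nat.card {t // W t = i} := by
  classical
  have hker : LinearMap.ker (Ideal.Quotient.mkₐ ℂ J).toLinearMap =
      LinearMap.ker (markedMap π p) := by
    ext f
    simp [LinearMap.mem_ker, ← hJ, Ideal.Quotient.eq_zero_iff_mem]
  rw [gradedPiece, finrank_map_eq_of_ker_eq _ _ hker]
  have hmap : (MvPolynomial.weightedHomogeneousSubmodule ℂ w i).map (markedMap π p) =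
      Finsupp.supported ℂ ℂ {t | W t = i} := by
    rw [MvPolynomial.weightedHomogeneousSubmodule_eq_finsupp_supported,
      AddMonoidAlgebra.supported_eq_span_single, Submodule.map_span,
      Finsupp.supported_eq_span_single]
    apply le_antisymm
    · rw [Submodule.span_le]
      rintro _ ⟨_, ⟨a, ha, rfl⟩, rfl⟩
      have := markedMap_monomial π p a 1
      change markedMap π p (MvPolynomial.monomial a 1) ∈ _
      rw [this]
      split_ifs with hp
      · exact Submodule.subset_span ⟨π a, by rw [Set.mem_ofPred_eq, ← hw a hp]; exact ha, rfl⟩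
      · exact zero_mem _
    · rw [Submodule.span_le]
      rintro _ ⟨t, ht, rfl⟩
      obtain ⟨a, hp, rfl⟩ := hsurj t
      refine Submodule.subset_span ⟨MvPolynomial.monomial a 1, ⟨a, ?_, rfl⟩, ?_⟩
      · rw [Set.mem_ofPred_eq, hw a hp]; exact ht
      · rw [markedMap_monomial, if_pos hp]
  rw [hmap, (Finsupp.supportedEquivFinsupp {t | W t = i}).finrank_eq]
  have : Fintype {t | W t = i} := Fintype.ofFinite {t // W t = i}
  rw [Module.finrank_finsupp_self, ← Nat.card_eq_fintype_card]
  rfl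

/-- Regroup the sum over `T` by the fibres of `W`. Summability makes every fibre finite, since its
terms are a positive constant. -/
theorem hilbertSeries_eq {ι T : Type} {π : (ι →₀ ℕ) → T} {p : (ι →₀ ℕ) → Prop}
    {J : Ideal (MvPolynomial ι ℂ)} (hJ : ∀ f, f ∈ J ↔ markedMap π p f = 0)
    (hsurj : ∀ t, ∃ a, p a ∧ π a = t) {w : ι → ℝ} {W : T → ℝ}
    (hw : ∀ a, p a → Finsupp.weight w a = W (π a)) {s G : ℝ}
    (hG : HasSum (fun t => Real.exp (-(s * W t))) G) : hilbertSeries J w s = G := by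
  have hs : HasSum (fun x : Σ i, {t // W t = i} => Real.exp (-(s * x.1))) G := by
    have h := (Equiv.sigmaFiberEquiv W).hasSum_iff.mpr hG
    refine h.congr_fun ?_ |> id
    rintro ⟨i, t, rfl⟩
    rfl
  have hfin : ∀ i, Finite {t // W t = i} := by
    intro i
    have h : Summable fun _ : {t // W t = i} => Real.exp (-(s * i)) :=
      hs.summable.sigma_factor i
    exact Finite.of_summable_const (Real.exp_pos _) h
  have h : HasSum (fun i : ℝ => (Module.finrank ℂ (gradedPiece J w i) : ℝ) *
      Real.exp (-(s * i))) G := by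
    refine hs.sigma fun i => ?_
    have := hfin i
    have := Fintype.ofFinite {t // W t = i}
    rw [finrank_gradedPiece hJ hsurj hw i, Nat.card_eq_fintype_card]
    convert hasSum_fintype (fun _ : {t // W t = i} => Real.exp (-(s * i))) using 1
    simp
  exact h.tsum_eq

/-! ### Toric ideals as kernels of marked maps -/

/-- The kernel of `ℂ[x] → ℂ[T]` sending each variable to its generator. -/
noncomputable abbrev monoidIdeal {ι T : Type} [AddCommMonoid T] (gen : ι → T) :
    Ideal (MvPolynomial ι ℂ) :=
  RingHom.ker (MvPolynomial.aeval
    (fun i => (AddMonoidAlgebra.single (gen i) 1 : AddMonoidAlgebra ℂ T)) :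
      MvPolynomial ι ℂ →ₐ[ℂ] AddMonoidAlgebra ℂ T)

theorem aeval_single_monomial {ι T : Type} [AddCommMonoid T] (gen : ι → T) (a : ι →₀ ℕ) (c : ℂ) :
    MvPolynomial.aeval (fun i => (AddMonoidAlgebra.single (gen i) 1 : AddMonoidAlgebra ℂ T))
      (MvPolynomial.monomial a c) = AddMonoidAlgebra.single (Finsupp.weight gen a) c := by
  classical
  rw [MvPolynomial.aeval_monomial, Finsupp.weight_apply]
  have h : (a.prod fun i k => (AddMonoidAlgebra.single (gen i) 1 : AddMonoidAlgebra ℂ T) ^ k) =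
      AddMonoidAlgebra.single (a.sum fun i k => k • gen i) 1 := by
    simp only [Finsupp.prod, Finsupp.sum, AddMonoidAlgebra.single_pow, one_pow]
    induction a.support using Finset.induction_on with
    | empty => simp [AddMonoidAlgebra.one_def]
    | insert i s hi ih =>
      rw [Finset.prod_insert hi, Finset.sum_insert hi, ih, AddMonoidAlgebra.single_mul_single,
        one_mul]
  rw [h, AddMonoidAlgebra.coe_algebraMap]
  simp [AddMonoidAlgebra.single_mul_single]

theorem mem_monoidIdeal_iff {ι T : Type} [AddCommMonoid T] (gen : ι → T)
    (f : MvPolynomial ι ℂ) :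
    f ∈ monoidIdeal gen ↔ markedMap (Finsupp.weight gen) (fun _ => True) f = 0 := by
  have h : ∀ f : MvPolynomial ι ℂ, (MvPolynomial.aeval
      (fun i => (AddMonoidAlgebra.single (gen i) 1 : AddMonoidAlgebra ℂ T)) f).coeff =
      markedMap (Finsupp.weight gen) (fun _ => True) f := by
    intro f
    induction f using MvPolynomial.induction_on' with
    | monomial a c => rw [aeval_single_monomial, markedMap_monomial, if_pos trivial]; rfl
    | add p q hp hq => rw [map_add, map_add, ← hp, ← hq]; rfl
  rw [← h, RingHom.mem_ker]
  exact AddMonoidAlgebra.coeff_eq_zero.symm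

/-! ### The flat limit along a test symmetry -/

section CentralFibre

variable {ι T : Type} [AddCommMonoid T] (gen : ι → T) (h : ι) (σ : T → ι →₀ ℕ)

/-- The monomials of maximal `x_h`-exponent among those representing the same element of `T`. -/
def MaxExponent (a : ι →₀ ℕ) : Prop := a h = σ (Finsupp.weight gen a) h

variable {gen h σ}

/-- A multiple of a non-maximal monomial is non-maximal: exchanging the factor for a maximal
representative raises the `h`-exponent. So multiplication by a monomial descends to an operator `M`
on the target, and the kernel is stable under it. -/
theorem markedMap_monomial_mul (hσ : ∀ t, Finsupp.weight gen (σ t) = t)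
    (hmax : ∀ a, a h ≤ σ (Finsupp.weight gen a) h) (c : ι →₀ ℕ) (z : ℂ) (f : MvPolynomial ι ℂ)
    (hf : markedMap (Finsupp.weight gen) (MaxExponent gen h σ) f = 0) :
    markedMap (Finsupp.weight gen) (MaxExponent gen h σ) (MvPolynomial.monomial c z * f) = 0 := by
  classical
  let M : (T →₀ ℂ) →ₗ[ℂ] (T →₀ ℂ) := Finsupp.linearCombination ℂ fun t =>
    if σ t h + c h = σ (t + Finsupp.weight gen c) h then
      Finsupp.single (t + Finsupp.weight gen c) z else 0
  have key : ∀ f, markedMap (Finsupp.weight gen) (MaxExponent gen h σ)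
      (MvPolynomial.monomial c z * f) =
      M (markedMap (Finsupp.weight gen) (MaxExponent gen h σ) f) := by
    intro f
    induction f using MvPolynomial.induction_on' with
    | add p q hp hq => rw [mul_add, map_add, map_add, map_add, hp, hq]
    | monomial a y =>
      rw [MvPolynomial.monomial_mul, markedMap_monomial, markedMap_monomial]
      by_cases ha : MaxExponent gen h σ a
      · rw [if_pos ha, Finsupp.linearCombination_single, MaxExponent, map_add, ← ha,
          add_comm (Finsupp.weight gen c), Finsupp.add_apply, add_comm (c h)]
        split_ifs <;> simp [mul_comm]
      · rw [if_neg ha, map_zero, if_neg]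
        intro hca
        have h1 := hmax a
        have h2 := hmax (c + σ (Finsupp.weight gen a))
        rw [MaxExponent] at ha hca
        simp only [map_add, hσ, Finsupp.add_apply] at h2 hca
        omega
  rw [key, hf, map_zero]

theorem markedMap_mul (hσ : ∀ t, Finsupp.weight gen (σ t) = t)
    (hmax : ∀ a, a h ≤ σ (Finsupp.weight gen a) h) (g f : MvPolynomial ι ℂ)
    (hf : markedMap (Finsupp.weight gen) (MaxExponent gen h σ) f = 0) :
    markedMap (Finsupp.weight gen) (MaxExponent gen h σ) (g * f) = 0 := by
  induction g using MvPolynomial.induction_on' with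
  | monomial c z => exact markedMap_monomial_mul hσ hmax c z f hf
  | add p q hp hq => rw [add_mul, map_add, hp, hq, add_zero]

theorem weight_indicator [DecidableEq ι] (h : ι) (a : ι →₀ ℕ) :
    Finsupp.weight (fun j => if j = h then (1 : ℕ) else 0) a = a h := by
  rw [← Finsupp.weight_single_one_apply h a]
  congr 2
  ext j
  simp [Pi.single_apply]

open Classical in
-- For `f` in the ideal, the coefficients over each `t` sum to zero, and all exponents of `h` in `f`
-- are at least `n`. If the maximal exponent over `t` is `n`, every monomial of `f` over `t`
-- survives in the component and the relation persists; otherwise no marked monomial over `t` occurs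
-- in it.
theorem markedMap_lowestComponent
    (hmax : ∀ a, a h ≤ σ (Finsupp.weight gen a) h) {f : MvPolynomial ι ℂ}
    (hf : f ∈ monoidIdeal gen) {n : ℕ}
    (hn : ∀ j < n, MvPolynomial.weightedHomogeneousComponent
      (fun j => if j = h then (1 : ℕ) else 0) j f = 0) :
    markedMap (Finsupp.weight gen) (MaxExponent gen h σ)
      (MvPolynomial.weightedHomogeneousComponent (fun j => if j = h then (1 : ℕ) else 0) n f) =
      0 := by
  have hsupp : ∀ d ∈ f.support, n ≤ d h := by
    intro d hd
    by_contra hlt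
    have h1 := congrArg (MvPolynomial.coeff d) (hn (d h) (not_le.mp hlt))
    rw [MvPolynomial.coeff_weightedHomogeneousComponent, weight_indicator, if_pos rfl] at h1
    exact (MvPolynomial.mem_support_iff.mp hd) h1
  rw [mem_monoidIdeal_iff] at hf
  have hf' : ∑ d ∈ f.support, Finsupp.single (Finsupp.weight gen d) (f.coeff d) = 0 := by
    rw [← hf]
    conv_rhs => rw [← MvPolynomial.support_sum_monomial_coeff f]
    rw [map_sum]
    exact Finset.sum_congr rfl fun d _ => by rw [markedMap_monomial, if_pos trivial]
  rw [MvPolynomial.weightedHomogeneousComponent_apply, map_sum, Finset.sum_filter]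
  ext t
  rw [Finsupp.finsetSum_apply, Finsupp.zero_apply]
  by_cases ht : σ t h = n
  · have h2 := DFunLike.congr_fun hf' t
    rw [Finsupp.finsetSum_apply, Finsupp.zero_apply] at h2
    rw [← h2]
    refine Finset.sum_congr rfl fun d hd => ?_
    rw [weight_indicator, markedMap_monomial]
    by_cases hdt : Finsupp.weight gen d = t
    · have h3 := hsupp d hd
      have h4 := hmax d
      rw [hdt, ht] at h4
      have h5 : d h = n := le_antisymm h4 h3
      rw [if_pos h5, if_pos (by rw [MaxExponent, hdt, ht, h5])]
    · rw [Finsupp.single_eq_of_ne (Ne.symm hdt)]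
      split_ifs <;> simp [Finsupp.single_eq_of_ne (Ne.symm hdt)]
  · refine Finset.sum_eq_zero fun d _ => ?_
    rw [weight_indicator, markedMap_monomial]
    split_ifs with h1 h2
    · by_cases hdt : Finsupp.weight gen d = t
      · rw [MaxExponent, hdt] at h2
        omega
      · exact Finsupp.single_eq_of_ne (Ne.symm hdt)
    · rfl
    · rfl

open Classical in
-- For the converse inclusion, the initial forms of the binomials `x ^ a - x ^ σ(t)` suffice to
-- reduce every polynomial to a combination of the chosen representatives, which the marked map
-- determines.
theorem mem_centralIdeal_iff (hσ : ∀ t, Finsupp.weight gen (σ t) = t)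
    (hmax : ∀ a, a h ≤ σ (Finsupp.weight gen a) h) (f : MvPolynomial ι ℂ) :
    f ∈ centralIdeal (monoidIdeal gen) (fun j => if j = h then (1 : ℕ) else 0) ↔
      markedMap (Finsupp.weight gen) (MaxExponent gen h σ) f = 0 := by
  constructor
  · intro hf
    induction hf using Submodule.span_induction with
    | mem p hp =>
      obtain ⟨f, hf, n, rfl, hn⟩ := hp
      exact markedMap_lowestComponent hmax hf hn
    | zero => exact map_zero _
    | add p q _ _ hp hq => rw [map_add, hp, hq, add_zero]
    | smul g p _ hp => exact markedMap_mul hσ hmax g p hp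
  · intro hf
    set J := centralIdeal (monoidIdeal gen) (fun j => if j = h then (1 : ℕ) else 0) with hJ
    let Θ : (T →₀ ℂ) →ₗ[ℂ] MvPolynomial ι ℂ :=
      Finsupp.linearCombination ℂ fun t => MvPolynomial.monomial (σ t) 1
    have hbin : ∀ (a b : ι →₀ ℕ) (c : ℂ), Finsupp.weight gen a = Finsupp.weight gen b →
        MvPolynomial.monomial a c - MvPolynomial.monomial b c ∈ monoidIdeal gen := by
      intro a b c hab
      rw [mem_monoidIdeal_iff, map_sub, markedMap_monomial, markedMap_monomial, hab, sub_self]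
    -- The lowest part of the binomial is the whole binomial if `a` is maximal, and the monomial `x
    -- ^ a` alone if not.
    have key : ∀ f, f - Θ (markedMap (Finsupp.weight gen) (MaxExponent gen h σ) f) ∈ J := by
      intro f
      induction f using MvPolynomial.induction_on' with
      | add p q hp hq =>
        rw [map_add, map_add, add_sub_add_comm]
        exact add_mem hp hq
      | monomial a c =>
        rw [markedMap_monomial]
        have hb := hbin a (σ (Finsupp.weight gen a)) c (hσ _).symm
        refine Ideal.subset_span ⟨_, hb, a h, ?_, fun j hj => ?_⟩
        · rw [map_sub, MvPolynomial.weightedHomogeneousComponent_eq_self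
            (MvPolynomial.isWeightedHomogeneous_monomial _ _ _ (weight_indicator h a))]
          split_ifs with ha
          · rw [MaxExponent] at ha
            rw [MvPolynomial.weightedHomogeneousComponent_eq_self
              (MvPolynomial.isWeightedHomogeneous_monomial _ _ _
                ((weight_indicator h _).trans ha.symm))]
            simp [Θ, Finsupp.linearCombination_single, MvPolynomial.smul_monomial]
          · rw [MvPolynomial.IsWeightedHomogeneous.weightedHomogeneousComponent_ne _
              (MvPolynomial.isWeightedHomogeneous_monomial _ _ _ (weight_indicator h _)) ha,
              map_zero]
        · ext d
          rw [MvPolynomial.coeff_weightedHomogeneousComponent, weight_indicator]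
          split_ifs with h1
          · have h4 := hmax a
            rw [MvPolynomial.coeff_sub, MvPolynomial.coeff_monomial, MvPolynomial.coeff_monomial,
              if_neg, if_neg, sub_self, MvPolynomial.coeff_zero]
            · rintro rfl; omega
            · rintro rfl; omega
          · simp
    have h1 := key f
    rwa [hf, map_zero, sub_zero] at h1

end CentralFibre

/-! ### Hilbert series of a monoid ring and of its flat limit -/

section MonoidSeries

variable {ι T : Type} [AddCommMonoid T] {gen : ι → T} (deg : T →+ ℝ)

theorem weight_comp_eq (a : ι →₀ ℕ) :
    Finsupp.weight (fun i => deg (gen i)) a = deg (Finsupp.weight gen a) := by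
  simp [Finsupp.weight_apply, map_finsuppSum]

theorem hilbertSeries_monoidIdeal (hgen : ∀ t, ∃ a : ι →₀ ℕ, Finsupp.weight gen a = t) {s G : ℝ}
    (hG : HasSum (fun t => Real.exp (-(s * deg t))) G) :
    hilbertSeries (monoidIdeal gen) (fun i => deg (gen i)) s = G :=
  hilbertSeries_eq (mem_monoidIdeal_iff gen)
    (fun t => (hgen t).imp fun _ ha => ⟨trivial, ha⟩) (fun a _ => weight_comp_eq deg a) hG

variable {deg}

theorem exponent_mul_le (hdeg : ∀ t, 0 ≤ deg t) (h : ι) (a : ι →₀ ℕ) :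
    (a h : ℝ) * deg (gen h) ≤ deg (Finsupp.weight gen a) := by
  conv_rhs => rw [← Finsupp.single_add_erase h a, map_add, map_add, Finsupp.weight_single, map_nsmul,
    nsmul_eq_mul]
  exact le_add_of_nonneg_right (hdeg _)

/-- A maximum exists because the exponent of `h` over `t` is at most `deg t / deg (gen h)`. -/
theorem exists_maxExponent_section (hgen : ∀ t, ∃ a : ι →₀ ℕ, Finsupp.weight gen a = t)
    (hdeg : ∀ t, 0 ≤ deg t) {h : ι} (hh : 0 < deg (gen h)) :
    ∃ σ : T → ι →₀ ℕ, (∀ t, Finsupp.weight gen (σ t) = t) ∧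
      ∀ a, a h ≤ σ (Finsupp.weight gen a) h := by
  have H : ∀ t, ∃ b : ι →₀ ℕ, Finsupp.weight gen b = t ∧
      ∀ a : ι →₀ ℕ, Finsupp.weight gen a = t → a h ≤ b h := by
    intro t
    let A : Set ℕ := {n | ∃ a, Finsupp.weight gen a = t ∧ a h = n}
    have hne : A.Nonempty := (hgen t).elim fun a ha => ⟨a h, a, ha, rfl⟩
    have hbdd : BddAbove A := by
      refine ⟨⌊deg t / deg (gen h)⌋₊, ?_⟩
      rintro n ⟨a, rfl, rfl⟩
      exact Nat.le_floor ((le_div_iff₀ hh).mpr (exponent_mul_le hdeg h a))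
    obtain ⟨b, hb, hbn⟩ := Nat.sSup_mem hne hbdd
    exact ⟨b, hb, fun a ha => hbn ▸ le_csSup hbdd ⟨a, ha, rfl⟩⟩
  choose σ h1 h2 using H
  exact ⟨σ, h1, fun a => h2 _ a rfl⟩

variable {h : ι} {σ : T → ι →₀ ℕ}

theorem exists_eq_add_gen (hσ : ∀ t, Finsupp.weight gen (σ t) = t) {t : T} (ht : σ t h ≠ 0) :
    ∃ a : ι →₀ ℕ, a h + 1 = σ t h ∧ Finsupp.weight gen a + gen h = t := by
  have hle : Finsupp.single h 1 ≤ σ t := by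
    rw [Finsupp.single_le_iff]
    omega
  refine ⟨σ t - Finsupp.single h 1, ?_, ?_⟩
  · simp
    omega
  · conv_rhs => rw [← hσ t, ← tsub_add_cancel_of_le hle, map_add, Finsupp.weight_single, one_smul]

/-- Cancellation lets one factor `x_h` be removed from a maximal representative of `t + gen h`,
leaving a representative of `t`. -/
theorem maxExponent_add_gen [IsCancelAdd T] (hσ : ∀ t, Finsupp.weight gen (σ t) = t)
    (hmax : ∀ a, a h ≤ σ (Finsupp.weight gen a) h) (t : T) : σ (t + gen h) h = σ t h + 1 := by
  have h1 := hmax (σ t + Finsupp.single h 1)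
  simp only [map_add, hσ, Finsupp.weight_single, one_smul, Finsupp.add_apply,
    Finsupp.single_eq_same] at h1
  obtain ⟨a, ha, hat⟩ := exists_eq_add_gen hσ (t := t + gen h) (h := h) (by omega)
  have h2 := hmax a
  rw [add_right_cancel hat] at h2
  omega

theorem tsum_eq_shift_add_compl [IsCancelAdd T] {F : T → ℝ} (hF : Summable F) (g : T) :
    ∑' t, F t = ∑' t, F (t + g) + ∑' t : ((Set.range (· + g))ᶜ : Set T), F t := by
  rw [← hF.tsum_subtype_add_tsum_subtype_compl (Set.range (· + g)),
    tsum_range F (add_left_injective g)]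

open Classical in
-- Off the translate of `T` by `gen h` the maximal exponent is 0, so the perturbed and unperturbed
-- sums agree there. On the translate both reproduce themselves, up to the factors e^(-s(q+ε)) and
-- e^(-sq). Hence (1 - e^(-s(q+ε))) times the perturbed sum equals (1 - e^(-sq)) times `g s`.
theorem perturbedSeries_monoidIdeal [IsCancelAdd T] (hgen : ∀ t, ∃ a : ι →₀ ℕ, Finsupp.weight gen a = t)
    (hdeg : ∀ t, 0 ≤ deg t) {h : ι} (hh : 0 < deg (gen h)) {g : ℝ → ℝ}
    (hg : ∀ s, 0 < s → HasSum (fun t => Real.exp (-(s * deg t))) (g s)) {ε : ℝ}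
    (hε : |ε| < deg (gen h)) {s : ℝ} (hs : 0 < s) :
    perturbedSeries (monoidIdeal gen) (fun i => deg (gen i)) (fun j => if j = h then 1 else 0) ε s =
      g s * ((1 - Real.exp (-(s * deg (gen h)))) / (1 - Real.exp (-(s * (deg (gen h) + ε))))) := by
  obtain ⟨σ, hσ, hmax⟩ := exists_maxExponent_section hgen hdeg hh
  set q := deg (gen h) with hq
  have hε' := abs_lt.mp hε
  let W : T → ℝ := fun t => deg t + ε * σ t h
  have hWadd : ∀ t, W (t + gen h) = W t + (q + ε) := by
    intro t
    simp only [W, maxExponent_add_gen hσ hmax, map_add, ← hq]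
    push_cast
    ring
  have hsum : Summable fun t => Real.exp (-(s * W t)) := by
    -- Since `q * σ t h ≤ deg t`, the perturbed weight is at least `(1 - |ε| / q) * deg t`; the
    -- unperturbed series at this smaller parameter dominates.
    have hpos : 0 < s * (1 - |ε| / q) :=
      mul_pos hs (sub_pos.mpr ((div_lt_one hh).mpr hε))
    refine (hg _ hpos).summable.of_nonneg_of_le (fun t => (Real.exp_pos _).le) fun t => ?_
    rw [Real.exp_le_exp, neg_le_neg_iff, mul_assoc]
    refine mul_le_mul_of_nonneg_left ?_ hs.le
    have h1 := exponent_mul_le (gen := gen) hdeg h (σ t)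
    rw [hσ, ← hq] at h1
    have h2 : |ε| * (σ t h : ℝ) ≤ |ε| / q * deg t := by
      rw [div_mul_eq_mul_div, le_div_iff₀ hh, mul_assoc]
      exact mul_le_mul_of_nonneg_left h1 (abs_nonneg ε)
    have h3 : -(|ε| * (σ t h : ℝ)) ≤ ε * σ t h := by
      rw [← neg_mul]
      exact mul_le_mul_of_nonneg_right (neg_abs_le ε) (Nat.cast_nonneg _)
    simp only [W]
    linarith
  have hcompl : ∑' t : ((Set.range (· + gen h))ᶜ : Set T), Real.exp (-(s * W t)) =
      ∑' t : ((Set.range (· + gen h))ᶜ : Set T), Real.exp (-(s * deg (t : T))) := by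
    refine tsum_congr fun ⟨t, ht⟩ => ?_
    have h0 : σ t h = 0 := by
      by_contra hne
      obtain ⟨a, -, hat⟩ := exists_eq_add_gen hσ hne
      exact ht ⟨_, hat⟩
    simp [W, h0]
  have hX : ∑' t, Real.exp (-(s * W t)) * (1 - Real.exp (-(s * (q + ε)))) =
      ∑' t, Real.exp (-(s * deg t)) * (1 - Real.exp (-(s * q))) := by
    have h1 := tsum_eq_shift_add_compl hsum (gen h)
    have h2 := tsum_eq_shift_add_compl (hg s hs).summable (gen h)
    rw [hcompl] at h1
    have h3 : ∀ t, Real.exp (-(s * W (t + gen h))) =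
        Real.exp (-(s * W t)) * Real.exp (-(s * (q + ε))) := by
      intro t
      rw [hWadd, ← Real.exp_add]
      ring_nf
    have h4 : ∀ t, Real.exp (-(s * deg (t + gen h))) =
        Real.exp (-(s * deg t)) * Real.exp (-(s * q)) := by
      intro t
      rw [map_add, ← hq, ← Real.exp_add]
      ring_nf
    rw [tsum_congr h3, tsum_mul_right] at h1
    rw [tsum_congr h4, tsum_mul_right] at h2
    rw [tsum_mul_right, tsum_mul_right]
    linarith
  have hne : 1 - Real.exp (-(s * (q + ε))) ≠ 0 := by
    have : Real.exp (-(s * (q + ε))) < 1 :=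
      Real.exp_lt_one_iff.mpr (neg_lt_zero.mpr (mul_pos hs (by linarith)))
    linarith
  rw [tsum_mul_right, tsum_mul_right, (hg s hs).tsum_eq] at hX
  refine hilbertSeries_eq (mem_centralIdeal_iff hσ hmax)
    (fun t => ⟨σ t, by rw [MaxExponent, hσ], hσ t⟩) (W := W) (fun a ha => ?_) ?_
  · rw [MaxExponent] at ha
    simp only [W, ← weight_comp_eq, ← ha]
    rw [Finsupp.weight_apply, Finsupp.weight_apply, ← weight_indicator h a, Finsupp.weight_apply]
    simp only [Finsupp.sum, Nat.cast_sum, Finset.mul_sum, ← Finset.sum_add_distrib]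
    refine Finset.sum_congr rfl fun i _ => ?_
    simp only [nsmul_eq_mul, smul_eq_mul]
    push_cast
    ring
  · rw [mul_div_assoc', ← hX, mul_div_cancel_right₀ _ hne]
    exact hsum.hasSum

end MonoidSeries

/-! ### The unimodular fan over the polar polygon -/

/-- The determinant of two vectors of `ℤ²`. -/
def det2 (p q : ℤ × ℤ) : ℤ := p.1 * q.2 - p.2 * q.1

/-- The boundary lattice points `u i` of the polar dual polygon in cyclic order. Consecutive points
span unimodular cones, which together form a complete fan in `ℤ²`, and lie on a common edge, dual to
the vertex `facet i` of the polygon. The sign conditions `disjoint` certify that the cones do not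
overlap; the positive relation `rel` among the `u i` certifies that they cover the plane. -/
structure BoundaryPoints (P : ReflexivePolygon) where
  n : ℕ
  u : Fin (n + 3) → ℤ × ℤ
  facet : Fin (n + 3) → Fin (P.k + 3)
  weight : Fin (n + 3) → ℤ
  det_eq_one : ∀ i, det2 (u i) (u (i + 1)) = 1
  vertex_facet : ∀ i, P.vertex (facet i) = ((u i).2 - (u (i + 1)).2, (u (i + 1)).1 - (u i).1)
  facet_surjective : ∀ α, ∃ i, facet i = α
  eq_facet : ∀ i α, (u i).1 * (P.vertex α).1 + (u i).2 * (P.vertex α).2 = -1 →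
    (u (i + 1)).1 * (P.vertex α).1 + (u (i + 1)).2 * (P.vertex α).2 = -1 → α = facet i
  neg_one_le : ∀ i α, -1 ≤ (u i).1 * (P.vertex α).1 + (u i).2 * (P.vertex α).2
  exists_one_le : ∀ i, ∃ α, 1 ≤ (u i).1 * (P.vertex α).1 + (u i).2 * (P.vertex α).2
  disjoint : ∀ i j, i ≠ j →
    (det2 (u j) (u i) < 0 ∧ det2 (u j) (u (i + 1)) ≤ 0) ∨
    (det2 (u i) (u (j + 1)) ≤ 0 ∧ det2 (u (i + 1)) (u (j + 1)) ≤ 0) ∨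
    (det2 (u i) (u j) < 0 ∧ det2 (u i) (u (j + 1)) ≤ 0) ∨
    (det2 (u j) (u (i + 1)) ≤ 0 ∧ det2 (u (j + 1)) (u (i + 1)) ≤ 0)
  weight_pos : ∀ i, 0 < weight i
  rel_fst : ∑ i, weight i * (u i).1 = 0
  rel_snd : ∑ i, weight i * (u i).2 = 0

theorem eq_combination_of_det2_eq_one {p q : ℤ × ℤ} (h : det2 p q = 1) (x : ℤ × ℤ) :
    x.1 = det2 x q * p.1 + det2 p x * q.1 ∧ x.2 = det2 x q * p.2 + det2 p x * q.2 := by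
  simp only [det2] at *
  constructor
  · linear_combination (-x.1) * h
  · linear_combination (-x.2) * h

theorem Fin.forall_or_forall_not_of_cyclic {n : ℕ} {p : Fin (n + 1) → Prop}
    (h : ∀ i, p i → p (i + 1)) : (∀ i, p i) ∨ ∀ i, ¬ p i := by
  by_cases h0 : p 0
  · left
    intro i
    induction i using Fin.induction with
    | zero => exact h0
    | succ i ih => simpa using h _ ih
  · right
    intro i
    induction i using Fin.reverseInduction with
    | last => exact fun hl => h0 (by simpa using h _ hl)
    | cast i ih => exact fun hc => ih (by simpa using h _ hc)

namespace BoundaryPoints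

variable {P : ReflexivePolygon} (D : BoundaryPoints P)

/-- Pairing the positive relation among the `u i` with `x` gives a vanishing sum of nonnegative
terms, so `x` is parallel to both vectors of a basis. -/
theorem eq_zero_of_det2_nonneg (x : ℤ × ℤ) (h : ∀ i, 0 ≤ det2 (D.u i) x) : x = 0 := by
  have hsum : ∑ i, D.weight i * det2 (D.u i) x = 0 := by
    have : ∑ i, D.weight i * det2 (D.u i) x =
        (∑ i, D.weight i * (D.u i).1) * x.2 - (∑ i, D.weight i * (D.u i).2) * x.1 := by
      rw [Finset.sum_mul, Finset.sum_mul, ← Finset.sum_sub_distrib]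
      exact Finset.sum_congr rfl fun i _ => by rw [det2]; ring
    rw [this, D.rel_fst, D.rel_snd]
    ring
  have h0 : ∀ i, det2 (D.u i) x = 0 := by
    intro i
    have h1 := (Finset.sum_eq_zero_iff_of_nonneg
      fun i _ => mul_nonneg (D.weight_pos i).le (h i)).mp hsum i (Finset.mem_univ i)
    exact (mul_eq_zero.mp h1).resolve_left (D.weight_pos i).ne'
  obtain ⟨h1, h2⟩ := eq_combination_of_det2_eq_one (D.det_eq_one 0) x
  have h3 := h0 0
  have h4 : det2 x (D.u (0 + 1)) = 0 := by
    have := h0 (0 + 1)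
    simp only [det2] at this ⊢
    linarith
  rw [h3, h4] at h1 h2
  exact Prod.ext (by simpa using h1) (by simpa using h2)

/-- If no cone contained `x`, the condition `0 ≤ det2 (u i) x` would pass from each `i` to `i + 1`,
hence hold for all `i` or for none; then `x` or `-x` would be zero. -/
theorem exists_cone {x : ℤ × ℤ} (hx : x ≠ 0) :
    ∃ i, 0 ≤ det2 (D.u i) x ∧ 0 < det2 x (D.u (i + 1)) := by
  by_contra! hcon
  have hswap : ∀ p q : ℤ × ℤ, det2 p q = -det2 q p := fun p q => by simp only [det2]; ring
  rcases Fin.forall_or_forall_not_of_cyclic (p := fun i => 0 ≤ det2 (D.u i) x)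
    (fun i hi => by have := hcon i hi; rw [hswap] at this; linarith) with h | h
  · exact hx (D.eq_zero_of_det2_nonneg x h)
  · refine hx (neg_eq_zero.mp (D.eq_zero_of_det2_nonneg (-x) fun i => ?_))
    have := h i
    simp only [det2, Prod.fst_neg, Prod.snd_neg] at this ⊢
    linarith

/-- Each cone contains its ray `u i` but not `u (i + 1)`. Expanding the coordinates of `x` in one
cone through those in the other, each alternative of `disjoint` contradicts a sign. -/
theorem cone_unique {x : ℤ × ℤ} {i j : Fin (D.n + 3)}
    (hi : 0 ≤ det2 (D.u i) x) (hi' : 0 < det2 x (D.u (i + 1)))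
    (hj : 0 ≤ det2 (D.u j) x) (hj' : 0 < det2 x (D.u (j + 1))) : i = j := by
  by_contra hne
  have key : ∀ i j : Fin (D.n + 3),
      det2 (D.u j) x = det2 x (D.u (i + 1)) * det2 (D.u j) (D.u i) +
        det2 (D.u i) x * det2 (D.u j) (D.u (i + 1)) ∧
      det2 x (D.u (j + 1)) = det2 x (D.u (i + 1)) * det2 (D.u i) (D.u (j + 1)) +
        det2 (D.u i) x * det2 (D.u (i + 1)) (D.u (j + 1)) := by
    intro i j
    have h1 := D.det_eq_one i
    simp only [det2] at h1 ⊢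
    constructor
    · linear_combination (-((D.u j).1 * x.2 - (D.u j).2 * x.1)) * h1
    · linear_combination (-(x.1 * (D.u (j + 1)).2 - x.2 * (D.u (j + 1)).1)) * h1
  obtain ⟨k1, k2⟩ := key i j
  obtain ⟨k3, k4⟩ := key j i
  rcases D.disjoint i j hne with ⟨h1, h2⟩ | ⟨h1, h2⟩ | ⟨h1, h2⟩ | ⟨h1, h2⟩
  · linarith [mul_neg_of_pos_of_neg hi' h1, mul_nonpos_of_nonneg_of_nonpos hi h2]
  · linarith [mul_nonpos_of_nonneg_of_nonpos hi'.le h1, mul_nonpos_of_nonneg_of_nonpos hi h2]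
  · linarith [mul_neg_of_pos_of_neg hj' h1, mul_nonpos_of_nonneg_of_nonpos hj h2]
  · linarith [mul_nonpos_of_nonneg_of_nonpos hj'.le h1, mul_nonpos_of_nonneg_of_nonpos hj h2]

/-- The pairing of the point `(u, 1)` over a boundary point with a ray of the cone. -/
def pairing (i : Fin (D.n + 3)) (α : Fin (P.k + 3)) : ℤ :=
  (D.u i).1 * (P.vertex α).1 + (D.u i).2 * (P.vertex α).2 + 1

theorem pairing_nonneg (i : Fin (D.n + 3)) (α : Fin (P.k + 3)) : 0 ≤ D.pairing i α := by
  have := D.neg_one_le i α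
  rw [pairing]
  omega

end BoundaryPoints

theorem ReflexivePolygon.dotProduct_ray (P : ReflexivePolygon) (m : Fin 3 → ℤ)
    (α : Fin (P.k + 3)) :
    m ⬝ᵥ P.ray α = m 0 * (P.vertex α).1 + m 1 * (P.vertex α).2 + m 2 := by
  simp [dotProduct, Fin.sum_univ_three, ReflexivePolygon.ray]

namespace BoundaryPoints

variable {P : ReflexivePolygon} (D : BoundaryPoints P)

/-- The facet ray vanishes on `(u i, 1)` and `(u (i + 1), 1)` and is 1 on `(0, 0, 1)`, so this is
the `(0, 0, 1)`-coordinate of `m` in that basis. -/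
theorem dotProduct_ray_facet (m : Fin 3 → ℤ) (i : Fin (D.n + 3)) :
    m ⬝ᵥ P.ray (D.facet i) =
      m 2 - det2 (m 0, m 1) (D.u (i + 1)) - det2 (D.u i) (m 0, m 1) := by
  rw [P.dotProduct_ray, D.vertex_facet]
  simp only [det2]
  ring

/-- The lattice point with coordinates `k, b + 1, d` in the half-open unimodular cone spanned by
`(0, 0, 1)`, `(u i, 1)` and `(u (i + 1), 1)`. -/
def conePoint (i : Fin (D.n + 3)) (k b d : ℕ) : Fin 3 → ℤ :=
  ![(b + 1) * (D.u i).1 + d * (D.u (i + 1)).1, (b + 1) * (D.u i).2 + d * (D.u (i + 1)).2,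
    k + (b + 1) + d]

theorem conePoint_dotProduct_ray (i : Fin (D.n + 3)) (k b d : ℕ) (α : Fin (P.k + 3)) :
    D.conePoint i k b d ⬝ᵥ P.ray α = k + (b + 1) * D.pairing i α + d * D.pairing (i + 1) α := by
  rw [P.dotProduct_ray]
  simp only [conePoint, pairing, Matrix.cons_val]
  ring

theorem conePoint_mem (i : Fin (D.n + 3)) (k b d : ℕ) : D.conePoint i k b d ∈ P.semigroup := by
  intro α
  rw [conePoint_dotProduct_ray]
  have h1 := D.pairing_nonneg i α
  have h2 := D.pairing_nonneg (i + 1) α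
  positivity

theorem det2_conePoint (i : Fin (D.n + 3)) (k b d : ℕ) :
    det2 (D.u i) (D.conePoint i k b d 0, D.conePoint i k b d 1) = d ∧
    det2 (D.conePoint i k b d 0, D.conePoint i k b d 1) (D.u (i + 1)) = b + 1 := by
  have h1 := D.det_eq_one i
  simp only [det2, conePoint, Matrix.cons_val] at h1 ⊢
  constructor
  · linear_combination (d : ℤ) * h1
  · linear_combination ((b : ℤ) + 1) * h1

/-- Coordinates on the semigroup: multiples of `(0, 0, 1)`, and the points of the half-open cones. -/
def point : ℕ ⊕ (Fin (D.n + 3) × ℕ × ℕ × ℕ) → P.semigroup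
  | .inl k => ⟨![0, 0, k], fun α => by rw [P.dotProduct_ray]; simp⟩
  | .inr (i, k, b, d) => ⟨D.conePoint i k b d, D.conePoint_mem i k b d⟩

theorem point_injective : Function.Injective D.point := by
  have hcross : ∀ k i k' b d, D.point (.inl k) ≠ D.point (.inr (i, k', b, d)) := by
    intro k i k' b d h
    have h1 := congrArg Subtype.val h
    have h2 := (D.det2_conePoint i k' b d).2
    change ![0, 0, (k : ℤ)] = D.conePoint i k' b d at h1
    rw [← h1] at h2
    simp only [det2, Matrix.cons_val] at h2
    omega
  rintro (k | ⟨i, k, b, d⟩) (k' | ⟨i', k', b', d'⟩) h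
  · have h1 := congrFun (congrArg Subtype.val h) 2
    simp only [point, Matrix.cons_val] at h1
    rw [Nat.cast_inj.mp h1]
  · exact absurd h (hcross _ _ _ _ _)
  · exact absurd h.symm (hcross _ _ _ _ _)
  · have h1 : D.conePoint i k b d = D.conePoint i' k' b' d' := congrArg Subtype.val h
    obtain ⟨h2, h3⟩ := D.det2_conePoint i k b d
    obtain ⟨h4, h5⟩ := D.det2_conePoint i' k' b' d'
    rw [← h1] at h4 h5
    obtain rfl : i = i' := D.cone_unique (by rw [h2]; positivity) (by rw [h3]; positivity)
      (by rw [h4]; positivity) (by rw [h5]; positivity)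
    have h6 := congrFun h1 2
    simp only [conePoint, Matrix.cons_val] at h6
    obtain rfl : d = d' := by omega
    obtain rfl : b = b' := by omega
    obtain rfl : k = k' := by omega
    rfl

/-- The planar projection selects the cone and the coordinates along `u i` and `u (i + 1)`. The
remaining coordinate is the pairing with the facet ray, nonnegative by membership in the dual cone.
-/
theorem point_surjective : Function.Surjective D.point := by
  rintro ⟨m, hm⟩
  by_cases hx : ((m 0, m 1) : ℤ × ℤ) = 0
  · have h0 := hm 0
    simp only [Prod.mk_eq_zero] at hx
    rw [P.dotProduct_ray, hx.1, hx.2] at h0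
    refine ⟨.inl (m 2).toNat, Subtype.ext ?_⟩
    ext j
    fin_cases j
    · exact hx.1.symm
    · exact hx.2.symm
    · simp only [point, Fin.reduceFinMk, Matrix.cons_val]
      omega
  · obtain ⟨i, h1, h2⟩ := D.exists_cone hx
    have h3 := hm (D.facet i)
    rw [D.dotProduct_ray_facet] at h3
    obtain ⟨h4, h5⟩ := eq_combination_of_det2_eq_one (D.det_eq_one i) (m 0, m 1)
    obtain ⟨d, hd⟩ := Int.eq_ofNat_of_zero_le h1
    obtain ⟨b, hb⟩ := Int.eq_ofNat_of_zero_le (show 0 ≤ det2 (m 0, m 1) (D.u (i + 1)) - 1 by omega)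
    obtain ⟨k, hk⟩ := Int.eq_ofNat_of_zero_le h3
    have hb' : det2 (m 0, m 1) (D.u (i + 1)) = b + 1 := by omega
    rw [hd, hb'] at h4 h5
    refine ⟨.inr (i, k, b, d), Subtype.ext ?_⟩
    ext j
    fin_cases j
    · exact h4.symm
    · exact h5.symm
    · simp only [point, conePoint, Fin.reduceFinMk, Matrix.cons_val]
      omega

/-- The points of the semigroup are enumerated without repetition by `point`. -/
noncomputable def pointEquiv : ℕ ⊕ (Fin (D.n + 3) × ℕ × ℕ × ℕ) ≃ P.semigroup :=
  Equiv.ofBijective D.point ⟨D.point_injective, D.point_surjective⟩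

end BoundaryPoints

/-! ### The grading and the closed form of the Hilbert series -/

namespace ReflexivePolygon

variable (P : ReflexivePolygon)

/-- A generator as an element of the semigroup. -/
def genPoint (h : P.Gen) : P.semigroup := h.1

/-- The charge of an element of the semigroup, extending the charges of the generators. -/
noncomputable def degree (b : Fin (P.k + 3) → ℝ) : P.semigroup →+ ℝ where
  toFun m := ∑ α, b α * (((m : Fin 3 → ℤ) ⬝ᵥ P.ray α : ℤ) : ℝ)
  map_zero' := by simp
  map_add' x y := by
    simp only [AddSubmonoid.coe_add, add_dotProduct, Int.cast_add, mul_add, Finset.sum_add_distrib]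

theorem degree_apply (b : Fin (P.k + 3) → ℝ) (m : P.semigroup) :
    P.degree b m = ∑ α, b α * (((m : Fin 3 → ℤ) ⬝ᵥ P.ray α : ℤ) : ℝ) := rfl

theorem degree_nonneg {b : Fin (P.k + 3) → ℝ} (hb : ∀ α, 0 < b α) (m : P.semigroup) :
    0 ≤ P.degree b m :=
  P.degree_apply b m ▸ Finset.sum_nonneg fun α _ => mul_nonneg (hb α).le (Int.cast_nonneg (m.2 α))

end ReflexivePolygon

namespace BoundaryPoints

variable {P : ReflexivePolygon} (D : BoundaryPoints P)

/-- The charge of the point `(u i, 1)`. -/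
noncomputable def q (b : Fin (P.k + 3) → ℝ) (i : Fin (D.n + 3)) : ℝ :=
  ∑ α, b α * (D.pairing i α : ℝ)

theorem q_pos {b : Fin (P.k + 3) → ℝ} (hb : ∀ α, 0 < b α) (i : Fin (D.n + 3)) : 0 < D.q b i := by
  obtain ⟨α, hα⟩ := D.exists_one_le i
  refine Finset.sum_pos' (fun β _ => mul_nonneg (hb β).le (Int.cast_nonneg (D.pairing_nonneg i β)))
    ⟨α, Finset.mem_univ α, mul_pos (hb α) (Int.cast_pos.mpr ?_)⟩
  rw [pairing]
  omega

theorem degree_point_inl {b : Fin (P.k + 3) → ℝ} (hb : ∑ α, b α = 2) (k : ℕ) :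
    P.degree b (D.point (.inl k)) = 2 * k := by
  rw [P.degree_apply]
  simp only [P.dotProduct_ray, point, Matrix.cons_val]
  rw [← hb, Finset.sum_mul]
  exact Finset.sum_congr rfl fun α _ => by push_cast; ring

theorem degree_point_inr {b : Fin (P.k + 3) → ℝ} (hb : ∑ α, b α = 2) (i : Fin (D.n + 3))
    (k l d : ℕ) : P.degree b (D.point (.inr (i, k, l, d))) =
      2 * k + ((l + 1) * D.q b i + d * D.q b (i + 1)) := by
  rw [P.degree_apply]
  simp only [point, conePoint_dotProduct_ray, q]
  rw [← hb, Finset.sum_mul, Finset.mul_sum, Finset.mul_sum, ← Finset.sum_add_distrib,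
    ← Finset.sum_add_distrib]
  exact Finset.sum_congr rfl fun α _ => by push_cast; ring

/-- The value of the Hilbert series in closed form. -/
noncomputable def series (b : Fin (P.k + 3) → ℝ) (s : ℝ) : ℝ :=
  (1 + ∑ i, Real.exp (-(s * D.q b i)) /
    ((1 - Real.exp (-(s * D.q b i))) * (1 - Real.exp (-(s * D.q b (i + 1)))))) /
      (1 - Real.exp (-(s * 2)))

theorem hasSum_exp_nat_mul {x : ℝ} (hx : 0 < x) :
    HasSum (fun k : ℕ => Real.exp (-(k * x))) (1 - Real.exp (-x))⁻¹ := by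
  have h := hasSum_geometric_of_lt_one (Real.exp_pos (-x)).le
    (Real.exp_lt_one_iff.mpr (neg_lt_zero.mpr hx))
  convert h using 2 with k
  rw [← Real.exp_nat_mul]
  ring_nf

theorem hasSum_conePoints {x y z : ℝ} (hx : 0 < x) (hy : 0 < y) (hz : 0 < z) :
    HasSum (fun m : ℕ × ℕ × ℕ => Real.exp (-(m.1 * x)) *
      (Real.exp (-y) * Real.exp (-(m.2.1 * y)) * Real.exp (-(m.2.2 * z))))
      (Real.exp (-y) / ((1 - Real.exp (-y)) * (1 - Real.exp (-z))) / (1 - Real.exp (-x))) := by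
  have h2 := hasSum_exp_nat_mul hx
  have h3 := (hasSum_exp_nat_mul hy).mul_left (Real.exp (-y))
  have h4 := hasSum_exp_nat_mul hz
  have h34 := h3.mul h4 (h3.summable.mul_of_nonneg h4.summable
    (fun _ => by positivity) (fun _ => by positivity))
  have h234 := h2.mul h34 (h2.summable.mul_of_nonneg h34.summable
    (fun _ => by positivity) (fun _ => by positivity))
  have he : Real.exp (-y) / ((1 - Real.exp (-y)) * (1 - Real.exp (-z))) / (1 - Real.exp (-x)) =
      (1 - Real.exp (-x))⁻¹ *
        (Real.exp (-y) * (1 - Real.exp (-y))⁻¹ * (1 - Real.exp (-z))⁻¹) := by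
    rw [div_div, div_eq_mul_inv, mul_inv, mul_inv]
    ring
  rw [he]
  exact h234

theorem hasSum_fin_prod {n : ℕ} {β : Type} {f : Fin n → β → ℝ} {a : Fin n → ℝ}
    (hf : ∀ i, HasSum (f i) (a i)) (h0 : ∀ i x, 0 ≤ f i x) :
    HasSum (fun x : Fin n × β => f x.1 x.2) (∑ i, a i) := by
  have hsum : Summable fun x : Fin n × β => f x.1 x.2 := by
    rw [summable_prod_of_nonneg fun x => h0 x.1 x.2]
    exact ⟨fun i => (hf i).summable, (hasSum_fintype _).summable⟩
  have h := hsum.hasSum.prod_fiberwise hf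
  rw [(hasSum_fintype a).unique h]
  exact hsum.hasSum

/-- The enumeration turns the sum into one geometric series for the axis and a product of three for
each cone; the extra factor e^(-s q i) excludes a face of the half-open cone. -/
theorem hasSum_series {b : Fin (P.k + 3) → ℝ} (hb : ∀ α, 0 < b α) (hb2 : ∑ α, b α = 2) {s : ℝ}
    (hs : 0 < s) :
    HasSum (fun m : P.semigroup => Real.exp (-(s * P.degree b m))) (D.series b s) := by
  rw [← D.pointEquiv.hasSum_iff]
  have hr := hasSum_fin_prod (fun i => hasSum_conePoints (mul_pos hs two_pos)
    (mul_pos hs (D.q_pos hb i)) (mul_pos hs (D.q_pos hb (i + 1)))) (fun _ _ => by positivity)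
  have h := HasSum.sum (f := Sum.elim (fun k : ℕ => Real.exp (-(k * (s * 2)))) _)
    (hasSum_exp_nat_mul (mul_pos hs two_pos)) hr
  rw [series, add_div, Finset.sum_div, one_div]
  suffices hfun : (fun m : P.semigroup => Real.exp (-(s * P.degree b m))) ∘ D.pointEquiv =
      Sum.elim _ _ by rw [hfun]; exact h
  funext x
  rcases x with (k | ⟨i, k, l, d⟩)
  · change Real.exp (-(s * P.degree b (D.point (.inl k)))) = _
    rw [D.degree_point_inl hb2, Sum.elim_inl]
    ring_nf
  · change Real.exp (-(s * P.degree b (D.point (.inr (i, k, l, d))))) = _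
    rw [D.degree_point_inr hb2, Sum.elim_inr, ← Real.exp_add, ← Real.exp_add, ← Real.exp_add]
    ring_nf

/-! ### Height, irreducibles and generation by the Hilbert basis -/

theorem height_nonneg_and_eq_zero (D : BoundaryPoints P) (m : P.semigroup) :
    0 ≤ (m : Fin 3 → ℤ) 2 ∧ ((m : Fin 3 → ℤ) 2 = 0 → m = 0) := by
  obtain ⟨k | ⟨i, k, b, d⟩, rfl⟩ := D.point_surjective m
  · simp only [point, Matrix.cons_val]
    refine ⟨by positivity, fun h => Subtype.ext ?_⟩
    change ![0, 0, (k : ℤ)] = 0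
    rw [h]
    simp
  · simp only [point, conePoint, Matrix.cons_val]
    refine ⟨by positivity, fun h => ?_⟩
    omega

theorem eq_zero_of_isAddUnit (D : BoundaryPoints P) {m : P.semigroup} (h : IsAddUnit m) : m = 0 := by
  obtain ⟨l, hl⟩ := isAddUnit_iff_exists_neg.mp h
  have h1 := congrFun (congrArg Subtype.val hl) 2
  simp only [AddSubmonoid.coe_add, Pi.add_apply, AddSubmonoid.coe_zero, Pi.zero_apply] at h1
  have h2 := D.height_nonneg_and_eq_zero m
  have h3 := D.height_nonneg_and_eq_zero l
  exact h2.2 (by omega)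

/-- Induction on the height: it is additive and positive off zero, so both factors of a reducible
element are lower. -/
theorem exists_weight_eq (D : BoundaryPoints P) (m : P.semigroup) :
    ∃ a : P.Gen →₀ ℕ, Finsupp.weight P.genPoint a = m := by
  induction hN : ((m : Fin 3 → ℤ) 2).toNat using Nat.strong_induction_on generalizing m with
  | _ N ih =>
    by_cases hm : IsAddUnit m
    · exact ⟨0, by rw [map_zero, D.eq_zero_of_isAddUnit hm]⟩
    rcases addIrreducible_or_factor hm with h | ⟨x, y, hx, hy, rfl⟩
    · exact ⟨Finsupp.single (M := ℕ) (α := P.Gen) ⟨m, h⟩ 1,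
        (Finsupp.weight_single P.genPoint _ _).trans (one_smul _ _)⟩
    · have hpos : ∀ z : P.semigroup, ¬ IsAddUnit z → 0 < (z : Fin 3 → ℤ) 2 := by
        intro z hz
        have h := D.height_nonneg_and_eq_zero z
        refine lt_of_le_of_ne h.1 fun h0 => hz ?_
        rw [h.2 h0.symm]
        exact isAddUnit_zero
      have h1 := hpos x hx
      have h2 := hpos y hy
      simp only [AddSubmonoid.coe_add, Pi.add_apply] at hN
      obtain ⟨a, ha⟩ := ih _ (by omega) x rfl
      obtain ⟨b, hb⟩ := ih _ (by omega) y rfl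
      exact ⟨a + b, by rw [map_add, ha, hb]⟩

theorem addIrreducible_of_height_eq_one (D : BoundaryPoints P) {m : P.semigroup} (h : (m : Fin 3 → ℤ) 2 = 1) :
    AddIrreducible m := by
  refine ⟨fun hm => ?_, fun x y hxy => ?_⟩
  · rw [D.eq_zero_of_isAddUnit hm] at h
    simp at h
  · have hx := D.height_nonneg_and_eq_zero x
    have hy := D.height_nonneg_and_eq_zero y
    rw [hxy] at h
    simp only [AddSubmonoid.coe_add, Pi.add_apply] at h
    rcases eq_or_lt_of_le hx.1 with h0 | h0
    · left
      rw [hx.2 h0.symm]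
      exact isAddUnit_zero
    · right
      rw [hy.2 (by omega)]
      exact isAddUnit_zero

theorem _root_.ReflexivePolygon.toricIdeal_eq (P : ReflexivePolygon) :
    P.toricIdeal = monoidIdeal P.genPoint := rfl

theorem _root_.ReflexivePolygon.charge_eq (P : ReflexivePolygon) (b : Fin (P.k + 3) → ℝ) :
    P.charge b = fun h => P.degree b (P.genPoint h) := rfl

theorem degree_pos (D : BoundaryPoints P) {b : Fin (P.k + 3) → ℝ} (hb : ∀ α, 0 < b α)
    (hb2 : ∑ α, b α = 2) {m : P.semigroup} (hm : m ≠ 0) : 0 < P.degree b m := by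
  obtain ⟨k | ⟨i, k, l, d⟩, rfl⟩ := D.point_surjective m
  · rw [D.degree_point_inl hb2]
    have hk : k ≠ 0 := by
      rintro rfl
      exact hm (Subtype.ext (by simp [point]))
    positivity
  · rw [D.degree_point_inr hb2]
    have h1 := D.q_pos hb i
    have h2 := D.q_pos hb (i + 1)
    positivity

theorem genPoint_ne_zero (h : P.Gen) : P.genPoint h ≠ 0 := fun h0 =>
  h.2.not_isAddUnit (show IsAddUnit (P.genPoint h) by rw [h0]; exact isAddUnit_zero)

theorem one_le_height_genPoint (D : BoundaryPoints P) (h : P.Gen) :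
    1 ≤ (P.genPoint h : Fin 3 → ℤ) 2 := by
  have h1 := D.height_nonneg_and_eq_zero (P.genPoint h)
  have h2 : (P.genPoint h : Fin 3 → ℤ) 2 ≠ 0 := fun h0 => genPoint_ne_zero h (h1.2 h0)
  omega

theorem charge_pos (D : BoundaryPoints P) {b : Fin (P.k + 3) → ℝ} (hb : ∀ α, 0 < b α)
    (hb2 : ∑ α, b α = 2) (h : P.Gen) : 0 < P.charge b h :=
  D.degree_pos hb hb2 (genPoint_ne_zero h)

theorem perturbedSeries_toricIdeal {b : Fin (P.k + 3) → ℝ} (hb : ∀ α, 0 < b α)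
    (hb2 : ∑ α, b α = 2) (h : P.Gen) {ε : ℝ} (hε : |ε| < P.charge b h) {s : ℝ} (hs : 0 < s) :
    perturbedSeries P.toricIdeal (P.charge b) (P.testSymmetry h) ε s = D.series b s *
      ((1 - Real.exp (-(s * P.charge b h))) / (1 - Real.exp (-(s * (P.charge b h + ε))))) :=
  perturbedSeries_monoidIdeal D.exists_weight_eq (P.degree_nonneg hb) (D.charge_pos hb hb2 h)
    (fun _ => D.hasSum_series hb hb2) hε hs

theorem hilbertSeries_toricIdeal {b : Fin (P.k + 3) → ℝ} (hb : ∀ α, 0 < b α)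
    (hb2 : ∑ α, b α = 2) {s : ℝ} (hs : 0 < s) :
    hilbertSeries P.toricIdeal (P.charge b) s = D.series b s := by
  rw [P.toricIdeal_eq, P.charge_eq]
  have h1 := D.hasSum_series hb hb2 hs
  have h2 := D.exists_weight_eq
  exact hilbertSeries_monoidIdeal (P.degree b) h2 h1

/-- Either `m` is a multiple of `(0, 0, 1)`, or it pairs to at least `2` with some ray. -/
theorem eq_or_exists_two_le (D : BoundaryPoints P) (m : P.semigroup) :
    ((m : Fin 3 → ℤ) 0 = 0 ∧ (m : Fin 3 → ℤ) 1 = 0) ∨ ∃ α, 2 ≤ (m : Fin 3 → ℤ) ⬝ᵥ P.ray α := by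
  obtain ⟨k | ⟨i, k, b, d⟩, rfl⟩ := D.point_surjective m
  · exact .inl ⟨rfl, rfl⟩
  · right
    obtain ⟨α, hα⟩ := D.exists_one_le i
    refine ⟨α, ?_⟩
    change 2 ≤ D.conePoint i k b d ⬝ᵥ P.ray α
    rw [D.conePoint_dotProduct_ray]
    have h1 : 2 ≤ D.pairing i α := by rw [pairing]; omega
    have h2 := mul_nonneg (Nat.cast_nonneg (α := ℤ) d) (D.pairing_nonneg (i + 1) α)
    have h3 := mul_nonneg (Nat.cast_nonneg (α := ℤ) b) (D.pairing_nonneg i α)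
    have h4 := Nat.cast_nonneg (α := ℤ) k
    linarith

end BoundaryPoints

/-! ### Uniqueness of Laurent expansions -/

section Laurent

theorem hasLaurentExpansion_of_analyticAt {n : ℕ} {g G : ℝ → ℝ} (hG : AnalyticAt ℝ G 0)
    (h : ∀ᶠ s in 𝓝[>] (0 : ℝ), s ^ n * g s = G s) :
    HasLaurentExpansion n g (fun m => iteratedDeriv m G 0 / m.factorial) := by
  have h1 := hasFPowerSeriesAt_iff.mp hG.hasFPowerSeriesAt
  filter_upwards [h, h1.filter_mono nhdsWithin_le_nhds, self_mem_nhdsWithin] with s hs hs1 hs0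
  have hs0' : s ≠ 0 := (Set.mem_Ioi.mp hs0).ne'
  rw [zero_add, ← hs] at hs1
  have h2 := hs1.mul_left (s ^ n)⁻¹
  rw [inv_mul_cancel_left₀ (pow_ne_zero n hs0')] at h2
  refine h2.congr_fun fun m => ?_
  rw [FormalMultilinearSeries.coeff_ofScalars, smul_eq_mul, zpow_sub₀ hs0', zpow_natCast, zpow_natCast]
  field_simp

theorem hasFPowerSeriesAt_of_hasSum {a : ℕ → ℝ} {s : ℝ} (hs : 0 < s)
    (h : Summable fun m => a m * s ^ m) :
    HasFPowerSeriesAt (FormalMultilinearSeries.ofScalars ℝ a).sum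
      (FormalMultilinearSeries.ofScalars ℝ a) (0 : ℝ) := by
  refine (FormalMultilinearSeries.hasFPowerSeriesOnBall _ ?_).hasFPowerSeriesAt
  have h1 : Tendsto (fun m => ‖FormalMultilinearSeries.ofScalars ℝ a m‖ *
      ((⟨s, hs.le⟩ : NNReal) : ℝ) ^ m) atTop (𝓝 0) := by
    have h2 := h.tendsto_atTop_zero.norm
    rw [norm_zero] at h2
    refine h2.congr fun m => ?_
    rw [FormalMultilinearSeries.ofScalars_norm, norm_mul, norm_pow, Real.norm_of_nonneg hs.le]
  refine lt_of_lt_of_le ?_ (FormalMultilinearSeries.le_radius_of_tendsto _ h1)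
  exact ENNReal.coe_pos.mpr hs

/-- After multiplication by `s ^ n` both expansions are analytic at 0 and agree on a right
neighbourhood, which accumulates at 0. This removes the choice in `laurentCoeff`. -/
theorem HasLaurentExpansion.unique {n : ℕ} {g : ℝ → ℝ} {a a' : ℕ → ℝ}
    (h : HasLaurentExpansion n g a) (h' : HasLaurentExpansion n g a') : a = a' := by
  have key : ∀ {a : ℕ → ℝ}, HasLaurentExpansion n g a → ∀ᶠ s in 𝓝[>] (0 : ℝ),
      HasSum (fun m => a m * s ^ m) (s ^ n * g s) := by
    intro a ha
    filter_upwards [ha, self_mem_nhdsWithin] with s hs hs0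
    have hs0' : s ≠ 0 := (Set.mem_Ioi.mp hs0).ne'
    have h1 := hs.mul_left (s ^ n)
    refine h1.congr_fun fun m => ?_
    rw [zpow_sub₀ hs0', zpow_natCast, zpow_natCast]
    field_simp
  have hsum : ∀ (a : ℕ → ℝ) (s : ℝ),
      (FormalMultilinearSeries.ofScalars ℝ a).sum s = ∑' m, a m * s ^ m := by
    intro a s
    rw [FormalMultilinearSeries.sum]
    refine tsum_congr fun m => ?_
    simp [FormalMultilinearSeries.ofScalars]
  have hk := key h
  have hk' := key h'
  obtain ⟨s, ⟨h1, h2⟩, hs⟩ := ((hk.and hk').and self_mem_nhdsWithin).exists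
  have p1 := hasFPowerSeriesAt_of_hasSum hs h1.summable
  have p2 := hasFPowerSeriesAt_of_hasSum hs h2.summable
  have heq : ∀ᶠ s in 𝓝[>] (0 : ℝ), (FormalMultilinearSeries.ofScalars ℝ a).sum s =
      (FormalMultilinearSeries.ofScalars ℝ a').sum s := by
    filter_upwards [hk, hk'] with s h1 h2
    rw [hsum, hsum, h1.tsum_eq, h2.tsum_eq]
  have hfreq := heq.frequently.filter_mono (nhdsWithin_mono (0 : ℝ)
    (fun x (hx : 0 < x) => (hx.ne' : x ∈ ({0}ᶜ : Set ℝ))))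
  have hev := (p1.analyticAt.frequently_eq_iff_eventually_eq p2.analyticAt).mp hfreq
  have := p1.eq_formalMultilinearSeries_of_eventually p2 hev
  ext m
  simpa using congrArg (fun p => FormalMultilinearSeries.coeff p m) this

theorem laurentCoeff_eq {n : ℕ} {g : ℝ → ℝ} {a : ℕ → ℝ} (h : HasLaurentExpansion n g a) :
    laurentCoeff n g = a := by
  ext m
  have hex : ∃ a, HasLaurentExpansion n g a := ⟨a, h⟩
  rw [laurentCoeff, dif_pos hex, hex.choose_spec.unique h]

end Laurent

/-! ### The Todd function -/

/-- The Todd function `x / (1 - exp (-x))`, extended to `0` by `1`. -/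
noncomputable def todd (x : ℝ) : ℝ := (dslope (fun y => 1 - Real.exp (-y)) 0 x)⁻¹

theorem todd_zero : todd 0 = 1 := by
  have h : HasDerivAt (fun y : ℝ => 1 - Real.exp (-y)) 1 0 := by
    simpa using ((hasDerivAt_neg (0 : ℝ)).exp).const_sub 1
  rw [todd, dslope_same, h.deriv, inv_one]

theorem todd_of_ne {x : ℝ} (hx : x ≠ 0) : todd x = x / (1 - Real.exp (-x)) := by
  rw [todd, dslope_of_ne _ hx, slope_def_field]
  simp

theorem analyticAt_todd_zero : AnalyticAt ℝ todd 0 := by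
  have h : AnalyticAt ℝ (fun y : ℝ => 1 - Real.exp (-y)) 0 := by fun_prop
  obtain ⟨p, hp⟩ := h
  refine AnalyticAt.inv ⟨_, hp.has_fpower_series_dslope_fslope⟩ ?_
  intro h0
  have := todd_zero
  rw [todd, h0, inv_zero] at this
  exact zero_ne_one this

theorem analyticAt_todd_mul (q : ℝ) : AnalyticAt ℝ (fun s => todd (s * q)) 0 := by
  refine AnalyticAt.fun_comp (f := fun s : ℝ => s * q) ?_ (by fun_prop)
  rw [zero_mul]
  exact analyticAt_todd_zero

theorem exp_neg_mul_todd (x : ℝ) : Real.exp (-x) * todd x = todd x - x := by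
  rcases eq_or_ne x 0 with rfl | hx
  · simp
  · have h : 1 - Real.exp (-x) ≠ 0 := by
      rw [sub_ne_zero]
      intro h
      exact hx (by simpa using (Real.exp_eq_one_iff _).mp h.symm)
    rw [todd_of_ne hx]
    field_simp
    ring

theorem todd_neg (x : ℝ) : todd (-x) = Real.exp (-x) * todd x := by
  rcases eq_or_ne x 0 with rfl | hx
  · simp
  · have h : 1 - Real.exp (-x) ≠ 0 := by
      rw [sub_ne_zero]
      intro h
      exact hx (by simpa using (Real.exp_eq_one_iff _).mp h.symm)
    have h' : 1 - Real.exp x ≠ 0 := by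
      rw [sub_ne_zero]
      intro h
      exact hx ((Real.exp_eq_one_iff _).mp h.symm)
    rw [todd_of_ne hx, todd_of_ne (neg_ne_zero.mpr hx), neg_neg, mul_div_assoc', div_eq_div_iff h' h]
    have h2 : Real.exp (-x) * Real.exp x = 1 := by rw [← Real.exp_add]; simp
    linear_combination x * h2

/-- Differentiating `todd (-x) = todd x - x` at 0 gives `-c = c - 1`. -/
theorem hasDerivAt_todd_zero : HasDerivAt todd (1 / 2) 0 := by
  have h := analyticAt_todd_zero.differentiableAt.hasDerivAt
  have h1 : HasDerivAt (fun x => todd (-x)) (-deriv todd 0) 0 := by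
    have := HasDerivAt.comp (0 : ℝ) (h₂ := todd) (h := fun x => -x) (h' := -1)
      (h₂' := deriv todd 0) (by rw [neg_zero]; exact h) (hasDerivAt_neg 0)
    rw [mul_neg, mul_one] at this
    exact this
  have h2 : HasDerivAt (fun x => todd x - x) (deriv todd 0 - 1) 0 := h.sub (hasDerivAt_id 0)
  have h3 : (fun x => todd (-x)) = fun x => todd x - x := by
    ext x
    rw [todd_neg, exp_neg_mul_todd]
  rw [h3] at h1
  have h4 := h1.unique h2
  have h5 : deriv todd 0 = 1 / 2 := by linarith
  rwa [h5] at h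

theorem Fin.sum_add_one {n : ℕ} {M : Type*} [AddCommMonoid M] (f : Fin (n + 1) → M) :
    ∑ i, f (i + 1) = ∑ i, f i :=
  Equiv.sum_comp (Equiv.addRight (1 : Fin (n + 1))) f

/-! ### The Gorenstein symmetry of the Hilbert series -/

namespace BoundaryPoints

variable {P : ReflexivePolygon} (D : BoundaryPoints P)

/-- The function `∑ i, 1 / (q i * q (i + 1))`, proportional to the volume. -/
noncomputable def vol (b : Fin (P.k + 3) → ℝ) : ℝ := ∑ i, 1 / (D.q b i * D.q b (i + 1))

/-- The analytic function `s ^ 3 * g s`, where `g` is the Hilbert series. -/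
noncomputable def numerator (b : Fin (P.k + 3) → ℝ) (s : ℝ) : ℝ :=
  todd (s * 2) / 2 * (s ^ 2 + ∑ i, Real.exp (-(s * D.q b i)) * todd (s * D.q b i) *
    todd (s * D.q b (i + 1)) * (1 / (D.q b i * D.q b (i + 1))))

theorem analyticAt_numerator (b : Fin (P.k + 3) → ℝ) : AnalyticAt ℝ (D.numerator b) 0 := by
  have h : ∀ i, AnalyticAt ℝ (fun s => todd (s * D.q b i)) 0 := fun i => analyticAt_todd_mul _
  have h2 := analyticAt_todd_mul 2
  have hsum : AnalyticAt ℝ (fun s => ∑ i, Real.exp (-(s * D.q b i)) * todd (s * D.q b i) *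
      todd (s * D.q b (i + 1)) * (1 / (D.q b i * D.q b (i + 1)))) 0 := by
    refine Finset.analyticAt_fun_sum _ fun i _ => ?_
    have h3 : AnalyticAt ℝ (fun s => Real.exp (-(s * D.q b i))) 0 := by fun_prop
    exact ((h3.mul (h i)).mul (h (i + 1))).mul analyticAt_const
  exact (h2.div_const).mul ((analyticAt_id.pow 2).add hsum)

theorem numerator_zero (b : Fin (P.k + 3) → ℝ) : D.numerator b 0 = D.vol b / 2 := by
  simp only [numerator, zero_mul, todd_zero, neg_zero, Real.exp_zero, vol]
  simp
  ring

theorem pow_mul_series {b : Fin (P.k + 3) → ℝ} (hb : ∀ α, 0 < b α) {s : ℝ} (hs : 0 < s) :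
    s ^ 3 * D.series b s = D.numerator b s := by
  have hne : ∀ x, 0 < x → 1 - Real.exp (-(s * x)) ≠ 0 := by
    intro x hx
    have := Real.exp_lt_one_iff.mpr (neg_lt_zero.mpr (mul_pos hs hx))
    exact (sub_pos.mpr this).ne'
  rw [series, numerator, todd_of_ne (mul_pos hs two_pos).ne', mul_div_assoc', mul_add, mul_one]
  have hterm : ∀ i, Real.exp (-(s * D.q b i)) * todd (s * D.q b i) *
      todd (s * D.q b (i + 1)) * (1 / (D.q b i * D.q b (i + 1))) =
      s ^ 2 * (Real.exp (-(s * D.q b i)) /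
    ((1 - Real.exp (-(s * D.q b i))) * (1 - Real.exp (-(s * D.q b (i + 1)))))) := by
    intro i
    have h1 := D.q_pos hb i
    have h2 := D.q_pos hb (i + 1)
    have h3 := hne _ h1
    have h4 := hne _ h2
    rw [todd_of_ne (mul_pos hs h1).ne', todd_of_ne (mul_pos hs h2).ne']
    field_simp
  rw [Finset.sum_congr rfl fun i _ => hterm i, ← Finset.mul_sum]
  have h5 := hne 2 two_pos
  field_simp

/-- Under `s ↦ -s` the term of each cone changes by a difference of `s * todd (s * q i) / q i`
between neighbours, which telescopes around the cycle. The prefactor `todd (s * 2)` supplies the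
exponential. -/
theorem exp_neg_mul_numerator_neg {b : Fin (P.k + 3) → ℝ} (hb : ∀ α, 0 < b α) (s : ℝ) :
    Real.exp s * D.numerator b (-s) = Real.exp (-s) * D.numerator b s := by
  have h2 : Real.exp s * todd (-s * 2) = Real.exp (-s) * todd (s * 2) := by
    rw [neg_mul, todd_neg, ← mul_assoc, ← Real.exp_add]
    ring_nf
  have hsum : ∑ i, Real.exp (-(-s * D.q b i)) * todd (-s * D.q b i) *
      todd (-s * D.q b (i + 1)) * (1 / (D.q b i * D.q b (i + 1))) =
      ∑ i, Real.exp (-(s * D.q b i)) * todd (s * D.q b i) *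
      todd (s * D.q b (i + 1)) * (1 / (D.q b i * D.q b (i + 1))) := by
    have hterm : ∀ i, Real.exp (-(-s * D.q b i)) * todd (-s * D.q b i) *
      todd (-s * D.q b (i + 1)) * (1 / (D.q b i * D.q b (i + 1))) =
      Real.exp (-(s * D.q b i)) * todd (s * D.q b i) *
      todd (s * D.q b (i + 1)) * (1 / (D.q b i * D.q b (i + 1))) +
      (s * (todd (s * D.q b (i + 1)) / D.q b (i + 1)) - s * (todd (s * D.q b i) / D.q b i)) := by
      intro i
      have h1 := (D.q_pos hb i).ne'
      have h2 := (D.q_pos hb (i + 1)).ne'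
      have h3 : Real.exp (-(-s * D.q b i)) * todd (-s * D.q b i) = todd (s * D.q b i) := by
        rw [neg_mul, todd_neg, ← mul_assoc, ← Real.exp_add]
        simp
      have h4 : todd (-s * D.q b (i + 1)) = todd (s * D.q b (i + 1)) - s * D.q b (i + 1) := by
        rw [neg_mul, todd_neg, exp_neg_mul_todd]
      rw [h3, h4, exp_neg_mul_todd]
      field_simp
      ring
    rw [Finset.sum_congr rfl fun i _ => hterm i, Finset.sum_add_distrib, Finset.sum_sub_distrib,
      Fin.sum_add_one fun i => s * (todd (s * D.q b i) / D.q b i), sub_self, add_zero]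
  rw [numerator, numerator, hsum, neg_sq]
  linear_combination (s ^ 2 + ∑ i, Real.exp (-(s * D.q b i)) * todd (s * D.q b i) *
      todd (s * D.q b (i + 1)) * (1 / (D.q b i * D.q b (i + 1)))) / 2 * h2

theorem iteratedDeriv_odd_eq_zero {f : ℝ → ℝ} (hf : ∀ x, f (-x) = f x) {n : ℕ} (hn : Odd n) :
    iteratedDeriv n f 0 = 0 := by
  have h := iteratedDeriv_comp_neg n f 0
  simp only [hf, neg_zero, hn.neg_one_pow, neg_smul, one_smul] at h
  linarith

/-- The Taylor coefficients of the numerator, as forced by its symmetry under `s ↦ -s`. -/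
theorem iteratedDeriv_numerator {b : Fin (P.k + 3) → ℝ} (hb : ∀ α, 0 < b α) :
    iteratedDeriv 1 (D.numerator b) 0 = D.numerator b 0 ∧
    iteratedDeriv 2 (D.numerator b) 0 / 2 - iteratedDeriv 3 (D.numerator b) 0 / 6 =
      D.numerator b 0 / 3 := by
  set K : ℝ → ℝ := fun s => Real.exp (-s) * D.numerator b s with hK
  have hKeven : ∀ s, K (-s) = K s := by
    intro s
    simp only [hK, neg_neg]
    exact D.exp_neg_mul_numerator_neg hb s
  have hKan : AnalyticAt ℝ K 0 :=
    AnalyticAt.mul (f := fun s => Real.exp (-s)) (by fun_prop) (D.analyticAt_numerator b)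
  have hG : D.numerator b = fun s => Real.exp s * K s := by
    ext s
    simp only [hK]
    rw [← mul_assoc, ← Real.exp_add, add_neg_cancel, Real.exp_zero, one_mul]
  have hder : ∀ n, iteratedDeriv n (D.numerator b) 0 =
      ∑ i ∈ Finset.range (n + 1), n.choose i * iteratedDeriv (n - i) K 0 := by
    intro n
    rw [hG, iteratedDeriv_fun_mul Real.contDiff_exp.contDiffAt hKan.contDiffAt]
    refine Finset.sum_congr rfl fun i _ => ?_
    rw [iteratedDeriv_eq_iterate, Real.iter_deriv_exp, Real.exp_zero, mul_one]
  have h0 : D.numerator b 0 = K 0 := by simp [hK]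
  have h1 := iteratedDeriv_odd_eq_zero hKeven (n := 1) (by decide)
  have h3 := iteratedDeriv_odd_eq_zero hKeven (n := 3) (by decide)
  -- The numerator is `exp * K` with `K` even; in the second identity `K''` cancels and `K 0 * (1/2
  -- - 1/6)` remains.
  rw [hder, hder, hder, h0]
  simp [Finset.sum_range_succ, h1, h3, Nat.choose]
  ring

end BoundaryPoints

/-! ### Laurent coefficients and the Futaki invariant -/

namespace BoundaryPoints

variable {P : ReflexivePolygon} (D : BoundaryPoints P)

theorem hasLaurentExpansion_hilbertSeries {b : Fin (P.k + 3) → ℝ} (hb : ∀ α, 0 < b α)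
    (hb2 : ∑ α, b α = 2) : HasLaurentExpansion 3 (hilbertSeries P.toricIdeal (P.charge b))
      (fun m => iteratedDeriv m (D.numerator b) 0 / m.factorial) := by
  refine hasLaurentExpansion_of_analyticAt (D.analyticAt_numerator b) ?_
  filter_upwards [self_mem_nhdsWithin] with s hs
  rw [D.hilbertSeries_toricIdeal hb hb2 hs, D.pow_mul_series hb hs]

theorem hasVolume {b : Fin (P.k + 3) → ℝ} (hb : ∀ α, 0 < b α) (hb2 : ∑ α, b α = 2) :
    P.HasVolume b (8 / 27 * (D.vol b / 2)) := by
  have h : Tendsto (D.numerator b) (𝓝[>] 0) (𝓝 (D.vol b / 2)) := by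
    rw [← D.numerator_zero]
    exact (D.analyticAt_numerator b).continuousAt.tendsto.mono_left nhdsWithin_le_nhds
  refine (h.const_mul (8 / 27)).congr' ?_
  filter_upwards [self_mem_nhdsWithin] with s hs
  rw [D.hilbertSeries_toricIdeal hb hb2 hs, D.pow_mul_series hb hs]

theorem vol_pos {b : Fin (P.k + 3) → ℝ} (hb : ∀ α, 0 < b α) : 0 < D.vol b :=
  Finset.sum_pos (fun i _ => one_div_pos.mpr (mul_pos (D.q_pos hb i) (D.q_pos hb (i + 1))))
    Finset.univ_nonempty

theorem isRCharge_iff {r : Fin (P.k + 3) → ℝ} : P.IsRCharge r ↔ (∀ α, 0 < r α) ∧ ∑ α, r α = 2 ∧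
    ∀ b : Fin (P.k + 3) → ℝ, (∀ α, 0 < b α) → ∑ α, b α = 2 → D.vol r ≤ D.vol b := by
  constructor
  · rintro ⟨h1, h2, V, hV, h3⟩
    refine ⟨h1, h2, fun b hb hb2 => ?_⟩
    obtain ⟨W, hW, hVW⟩ := h3 b hb hb2
    rw [tendsto_nhds_unique hV (D.hasVolume h1 h2),
      tendsto_nhds_unique hW (D.hasVolume hb hb2)] at hVW
    linarith
  · rintro ⟨h1, h2, h3⟩
    refine ⟨h1, h2, _, D.hasVolume h1 h2, fun b hb hb2 => ⟨_, D.hasVolume hb hb2, ?_⟩⟩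
    linarith [h3 b hb hb2]

section Futaki

variable {b : Fin (P.k + 3) → ℝ}

theorem coeffA_hilbertSeries (hb : ∀ α, 0 < b α) (hb2 : ∑ α, b α = 2) :
    coeffA (hilbertSeries P.toricIdeal (P.charge b)) 0 = D.vol b / 4 ∧
    coeffA (hilbertSeries P.toricIdeal (P.charge b)) 1 = D.vol b / 2 ∧
    coeffA (hilbertSeries P.toricIdeal (P.charge b)) 2 -
      coeffA (hilbertSeries P.toricIdeal (P.charge b)) 3 = D.vol b / 6 := by
  have h0 := D.numerator_zero b
  obtain ⟨h1, h2⟩ := D.iteratedDeriv_numerator hb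
  rw [h0] at h1 h2
  simp only [coeffA, laurentCoeff_eq (D.hasLaurentExpansion_hilbertSeries hb hb2)]
  refine ⟨?_, ?_, ?_⟩
  · simp [h0]
    ring
  · simp [-iteratedDeriv_one, h1]
  · norm_num [Nat.factorial]
    linarith

/-- The perturbing factor is `todd (s * (q + ε)) / todd (s * q)` times `q / (q + ε)`. The quotient
of Todd functions has value 1 and derivative `ε / 2` at 0, whence the factor `1 + ε / 2`. -/
theorem perturbedSeries_expansion (hb : ∀ α, 0 < b α) (hb2 : ∑ α, b α = 2) (h : P.Gen) {ε : ℝ}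
    (hε : |ε| < P.charge b h) :
    (∃ a, HasLaurentExpansion 3 (perturbedSeries P.toricIdeal (P.charge b) (P.testSymmetry h) ε) a)
    ∧ coeffA (perturbedSeries P.toricIdeal (P.charge b) (P.testSymmetry h) ε) 0 =
      D.vol b / 4 * (P.charge b h / (P.charge b h + ε))
    ∧ coeffA (perturbedSeries P.toricIdeal (P.charge b) (P.testSymmetry h) ε) 1 =
      D.vol b / 2 * (1 + ε / 2) * (P.charge b h / (P.charge b h + ε)) := by
  have hqε : 0 < P.charge b h + ε := by linarith [(abs_lt.mp hε).1]
  have hq := D.charge_pos hb hb2 h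
  set q := P.charge b h with hq_def
  let H : ℝ → ℝ := fun s => D.numerator b s * (todd (s * (q + ε)) / todd (s * q)) * (q / (q + ε))
  have htodd : ∀ x, todd (0 * x) = 1 := fun x => by rw [zero_mul, todd_zero]
  have hH : AnalyticAt ℝ H 0 :=
    ((D.analyticAt_numerator b).mul ((analyticAt_todd_mul (q + ε)).div (analyticAt_todd_mul q)
      (by rw [htodd]; exact one_ne_zero))).mul analyticAt_const
  have hexp : HasLaurentExpansion 3
      (perturbedSeries P.toricIdeal (P.charge b) (P.testSymmetry h) ε)
      (fun m => iteratedDeriv m H 0 / m.factorial) := by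
    refine hasLaurentExpansion_of_analyticAt hH ?_
    filter_upwards [self_mem_nhdsWithin] with s hs
    have hs' : 0 < s := hs
    have hne : ∀ x, 0 < x → 1 - Real.exp (-(s * x)) ≠ 0 := by
      intro x hx
      exact (sub_pos.mpr (Real.exp_lt_one_iff.mpr (neg_lt_zero.mpr (mul_pos hs hx)))).ne'
    have h1 := hne _ hq
    have h2 := hne _ hqε
    rw [D.perturbedSeries_toricIdeal hb hb2 h hε hs, ← mul_assoc, D.pow_mul_series hb hs,
      ← hq_def]
    simp only [H]
    rw [todd_of_ne (mul_pos hs hq).ne', todd_of_ne (mul_pos hs hqε).ne']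
    field_simp
  have hval : H 0 = D.vol b / 2 * (q / (q + ε)) := by
    simp only [H, htodd, D.numerator_zero]
    ring
  have htd : ∀ x, HasDerivAt (fun s => todd (s * x)) (x / 2) 0 := by
    intro x
    have h1 : HasDerivAt (fun s : ℝ => s * x) x 0 := by
      simpa using (hasDerivAt_id (0 : ℝ)).mul_const x
    have h2 := HasDerivAt.comp (0 : ℝ) (h₂ := todd) (h := fun s => s * x) (h₂' := 1 / 2)
      (by rw [zero_mul]; exact hasDerivAt_todd_zero) h1
    rw [one_div_mul_eq_div] at h2
    exact h2
  have hN : HasDerivAt (D.numerator b) (D.vol b / 2) 0 := by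
    have h1 := (D.iteratedDeriv_numerator hb).1
    rw [iteratedDeriv_one, D.numerator_zero] at h1
    rw [← h1]
    exact (D.analyticAt_numerator b).differentiableAt.hasDerivAt
  have hder : HasDerivAt H (D.vol b / 2 * (1 + ε / 2) * (q / (q + ε))) 0 := by
    have h1 := (hN.mul ((htd (q + ε)).div (htd q) (by rw [htodd]; exact one_ne_zero))).mul_const
      (q / (q + ε))
    refine HasDerivAt.congr_deriv h1 ?_
    simp only [htodd, D.numerator_zero, Pi.div_apply]
    ring
  refine ⟨⟨_, hexp⟩, ?_, ?_⟩
  · simp only [coeffA, laurentCoeff_eq hexp]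
    simp [hval]
    ring
  · simp only [coeffA, laurentCoeff_eq hexp, iteratedDeriv_one, hder.deriv]
    simp

/-- Near `ε = 0` the ratio A₁/A₀ is exactly `2 + ε`, and A₀ has derivative `-vol / (4 q)`. -/
theorem futaki_eq (hb : ∀ α, 0 < b α) (hb2 : ∑ α, b α = 2) (h : P.Gen) :
    FutakiDefined P.toricIdeal (P.charge b) (P.testSymmetry h) ∧
    P.futakiR b h = D.vol b / 8 - D.vol b / (12 * P.charge b h) := by
  have hq := D.charge_pos hb hb2 h
  obtain ⟨hA0, hA1, -⟩ := D.coeffA_hilbertSeries hb hb2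
  have hv := D.vol_pos hb
  set q := P.charge b h with hq_def
  have hev : ∀ᶠ ε in 𝓝 (0 : ℝ), |ε| < q := by
    have h1 : ContinuousAt (fun ε : ℝ => |ε|) 0 := continuous_abs.continuousAt
    exact h1.eventually_lt continuousAt_const (by simpa using hq)
  have hratio : HasDerivAt (fun ε =>
      coeffA (perturbedSeries P.toricIdeal (P.charge b) (P.testSymmetry h) ε) 1 /
      coeffA (perturbedSeries P.toricIdeal (P.charge b) (P.testSymmetry h) ε) 0) 1 0 := by
    have h1 : HasDerivAt (fun ε : ℝ => 2 + ε) 1 0 := (hasDerivAt_id 0).const_add 2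
    refine h1.congr_of_eventuallyEq ?_
    filter_upwards [hev] with ε hε
    obtain ⟨-, h2, h3⟩ := D.perturbedSeries_expansion hb hb2 h hε
    have hqε : 0 < q + ε := by linarith [(abs_lt.mp hε).1]
    rw [h2, h3, ← hq_def]
    field_simp
    ring
  have hlead : HasDerivAt (fun ε =>
      coeffA (perturbedSeries P.toricIdeal (P.charge b) (P.testSymmetry h) ε) 0)
      (-(D.vol b / (4 * q))) 0 := by
    have h1 : HasDerivAt (fun ε : ℝ => D.vol b / 4 * (q / (q + ε))) (-(D.vol b / (4 * q))) 0 := by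
      have h2 : HasDerivAt (fun ε : ℝ => q + ε) 1 0 := (hasDerivAt_id 0).const_add q
      have h3 := (((hasDerivAt_const (0 : ℝ) q).div h2 (by simpa using hq.ne')).const_mul
        (D.vol b / 4))
      refine h3.congr_deriv ?_
      simp only [add_zero]
      field_simp
      ring
    refine h1.congr_of_eventuallyEq ?_
    filter_upwards [hev] with ε hε
    exact (D.perturbedSeries_expansion hb hb2 h hε).2.1
  refine ⟨⟨⟨_, D.hasLaurentExpansion_hilbertSeries hb hb2⟩, by rw [hA0]; positivity, ?_,
    hratio.differentiableAt, hlead.differentiableAt⟩, ?_⟩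
  · filter_upwards [hev] with ε hε
    obtain ⟨h1, h2, -⟩ := D.perturbedSeries_expansion hb hb2 h hε
    have hqε : 0 < q + ε := by linarith [(abs_lt.mp hε).1]
    refine ⟨h1, ?_⟩
    rw [h2, ← hq_def]
    positivity
  · rw [ReflexivePolygon.futakiR, futaki, hratio.deriv, hlead.deriv, hA0, hA1]
    field_simp
    ring

end Futaki

end BoundaryPoints

/-! ### The Minkowski relation and existence of a minimiser -/

namespace BoundaryPoints

variable {P : ReflexivePolygon} (D : BoundaryPoints P)

theorem linear_eq {b : Fin (P.k + 3) → ℝ} (hb2 : ∑ α, b α = 2) (x y z : ℤ) :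
    ∑ α, b α * ((x * (P.vertex α).1 + y * (P.vertex α).2 + z : ℤ) : ℝ) =
      x * ∑ α, b α * (P.vertex α).1 + y * ∑ α, b α * (P.vertex α).2 + 2 * z := by
  rw [← hb2, Finset.mul_sum, Finset.mul_sum, Finset.sum_mul, ← Finset.sum_add_distrib,
    ← Finset.sum_add_distrib]
  exact Finset.sum_congr rfl fun α _ => by push_cast; ring

/-- The Minkowski relation: the Reeb vector is a combination of the rays of the cone. -/
theorem sum_mul_vol {b : Fin (P.k + 3) → ℝ} (hb2 : ∑ α, b α = 2) (hq : ∀ i, D.q b i ≠ 0)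
    (m : Fin 3 → ℤ) : (∑ α, b α * ((m ⬝ᵥ P.ray α : ℤ) : ℝ)) * D.vol b =
      2 * ∑ i, ((m ⬝ᵥ P.ray (D.facet i) : ℤ) : ℝ) * (1 / (D.q b i * D.q b (i + 1))) := by
  -- The error in each term is the increment of `det2 (m 0, m 1) (u j) / q j` from `j = i` to `j = i
  -- + 1`, so it telescopes around the cycle.
  have hterm : ∀ i, (∑ α, b α * ((m ⬝ᵥ P.ray α : ℤ) : ℝ)) * (1 / (D.q b i * D.q b (i + 1))) =
      2 * (((m ⬝ᵥ P.ray (D.facet i) : ℤ) : ℝ) * (1 / (D.q b i * D.q b (i + 1)))) +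
      ((m 0 * (D.u (i + 1)).2 - m 1 * (D.u (i + 1)).1) / D.q b (i + 1) -
        (m 0 * (D.u i).2 - m 1 * (D.u i).1) / D.q b i) := by
    intro i
    have h1 := hq i
    have h2 := hq (i + 1)
    have hd : ((D.u i).1 : ℝ) * (D.u (i + 1)).2 - (D.u i).2 * (D.u (i + 1)).1 = 1 := by
      have := D.det_eq_one i
      rw [det2] at this
      exact_mod_cast this
    have h3 : ∀ j, D.q b j = (D.u j).1 * ∑ α, b α * (P.vertex α).1 +
        (D.u j).2 * ∑ α, b α * (P.vertex α).2 + 2 := by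
      intro j
      have := linear_eq hb2 (D.u j).1 (D.u j).2 1
      rw [q]
      simp only [pairing, this]
      norm_num
    have h4 : ∑ α, b α * ((m ⬝ᵥ P.ray α : ℤ) : ℝ) = m 0 * ∑ α, b α * (P.vertex α).1 +
        m 1 * ∑ α, b α * (P.vertex α).2 + 2 * m 2 := by
      simp only [P.dotProduct_ray]
      exact linear_eq hb2 _ _ _
    have h5 : ((m ⬝ᵥ P.ray (D.facet i) : ℤ) : ℝ) = m 0 * ((D.u i).2 - (D.u (i + 1)).2) +
        m 1 * ((D.u (i + 1)).1 - (D.u i).1) + m 2 := by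
      rw [P.dotProduct_ray, D.vertex_facet]
      push_cast
      ring
    have h6 := h3 i
    have h7 := h3 (i + 1)
    rw [h4, h5]
    set X := ∑ α, b α * ((P.vertex α).1 : ℝ)
    set Y := ∑ α, b α * ((P.vertex α).2 : ℝ)
    field_simp
    rw [h6, h7]
    linear_combination (-(m 0 * X + m 1 * Y)) * hd
  rw [vol, Finset.mul_sum, Finset.sum_congr rfl fun i _ => hterm i, Finset.sum_add_distrib,
    Finset.sum_sub_distrib,
    Fin.sum_add_one fun i => ((m 0 * (D.u i).2 - m 1 * (D.u i).1) / D.q b i : ℝ), sub_self,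
    add_zero, Finset.mul_sum]

theorem pairing_eq_dotProduct (i : Fin (D.n + 3)) (α : Fin (P.k + 3)) :
    D.pairing i α = ![(D.u i).1, (D.u i).2, 1] ⬝ᵥ P.ray α := by
  rw [P.dotProduct_ray]
  rfl

/-- Charges for which all boundary points have positive weight are equivalent to positive ones. -/
theorem exists_pos_of_q_pos {b : Fin (P.k + 3) → ℝ} (hb2 : ∑ α, b α = 2)
    (hq : ∀ i, 0 < D.q b i) : ∃ r : Fin (P.k + 3) → ℝ, (∀ α, 0 < r α) ∧ ∑ α, r α = 2 ∧
      D.vol r = D.vol b := by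
  classical
  have hw : ∀ i, 0 < 1 / (D.q b i * D.q b (i + 1)) :=
    fun i => one_div_pos.mpr (mul_pos (hq i) (hq (i + 1)))
  have hv : 0 < D.vol b := Finset.sum_pos (fun i _ => hw i) Finset.univ_nonempty
  -- These are the coefficients of the Reeb vector in the Minkowski relation, collected by ray:
  -- positive, and defining the same grading as `b`.
  let r : Fin (P.k + 3) → ℝ := fun α =>
    2 / D.vol b * ∑ i with D.facet i = α, 1 / (D.q b i * D.q b (i + 1))
  have hr : ∀ m : Fin 3 → ℤ, ∑ α, r α * ((m ⬝ᵥ P.ray α : ℤ) : ℝ) =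
      ∑ α, b α * ((m ⬝ᵥ P.ray α : ℤ) : ℝ) := by
    intro m
    have h1 := D.sum_mul_vol hb2 (fun i => (hq i).ne') m
    have h2 : ∑ α, r α * ((m ⬝ᵥ P.ray α : ℤ) : ℝ) = 2 / D.vol b *
        ∑ i, ((m ⬝ᵥ P.ray (D.facet i) : ℤ) : ℝ) * (1 / (D.q b i * D.q b (i + 1))) := by
      rw [← Finset.sum_fiberwise Finset.univ D.facet, Finset.mul_sum]
      refine Finset.sum_congr rfl fun α _ => ?_
      simp only [r]
      rw [mul_assoc, Finset.sum_mul]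
      congr 1
      refine Finset.sum_congr rfl fun i hi => ?_
      rw [(Finset.mem_filter.mp hi).2, mul_comm]
    rw [h2, div_mul_eq_mul_div, ← h1, mul_div_cancel_right₀ _ hv.ne']
  refine ⟨r, fun α => ?_, ?_, ?_⟩
  · obtain ⟨i, hi⟩ := D.facet_surjective α
    exact mul_pos (div_pos two_pos hv) (Finset.sum_pos (fun j _ => hw j)
      ⟨i, Finset.mem_filter.mpr ⟨Finset.mem_univ i, hi⟩⟩)
  · have h := hr ![0, 0, 1]
    simpa [P.dotProduct_ray, hb2] using h
  · have h : ∀ i, D.q r i = D.q b i := by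
      intro i
      simp only [q, pairing_eq_dotProduct]
      exact hr _
    simp only [vol, h]

theorem continuous_q (i : Fin (D.n + 3)) : Continuous fun b => D.q b i := by
  unfold q
  fun_prop

/-- The open simplex is not compact, but `vol ≤ W` and the bound `q i ≤ M` force `q i ≥ 1 / (M *
W)`, which cuts a compact set out of the closed simplex. A minimiser there may have zero charges;
`exists_pos_of_q_pos` trades it for positive ones of the same volume. -/
theorem exists_isRCharge (D : BoundaryPoints P) : ∃ r, P.IsRCharge r := by
  let b₀ : Fin (P.k + 3) → ℝ := fun _ => 2 / (P.k + 3 : ℕ)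
  have hb₀ : ∀ α, 0 < b₀ α := fun α => by positivity
  have hb₀2 : ∑ α, b₀ α = 2 := by
    simp only [b₀, Finset.sum_const, Finset.card_univ, Fintype.card_fin, nsmul_eq_mul]
    field_simp
  have hW := D.vol_pos hb₀
  set W := D.vol b₀ with hW_def
  let M : ℝ := ∑ i, D.q (fun _ => 2) i
  have hq2 : ∀ i, 0 < D.q (fun _ => 2) i := D.q_pos fun _ => two_pos
  have hM : 0 < M := Finset.sum_pos (fun i _ => hq2 i) Finset.univ_nonempty
  have hqM : ∀ {b : Fin (P.k + 3) → ℝ}, (∀ α, b α ≤ 2) → ∀ i, D.q b i ≤ M := by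
    intro b hb i
    refine le_trans (Finset.sum_le_sum fun α _ => ?_)
      (Finset.single_le_sum (fun j _ => (hq2 j).le) (Finset.mem_univ i))
    exact mul_le_mul_of_nonneg_right (hb α) (Int.cast_nonneg (D.pairing_nonneg i α))
  let K : Set (Fin (P.k + 3) → ℝ) :=
    Set.Icc (fun _ => 0) (fun _ => 2) ∩ ({b | ∑ α, b α = 2} ∩ {b | ∀ i, 1 / (M * W) ≤ D.q b i})
  have hK : IsCompact K := by
    refine isCompact_Icc.inter_right (IsClosed.inter ?_ ?_)
    · exact isClosed_eq (by fun_prop) continuous_const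
    · rw [Set.ofPred_forall]
      exact isClosed_iInter fun i => isClosed_le continuous_const (D.continuous_q i)
  have hKq : ∀ b ∈ K, ∀ i, 0 < D.q b i := fun b hb i =>
    lt_of_lt_of_le (one_div_pos.mpr (mul_pos hM hW)) (hb.2.2 i)
  have hmem : ∀ b : Fin (P.k + 3) → ℝ, (∀ α, 0 < b α) → ∑ α, b α = 2 → D.vol b ≤ W → b ∈ K := by
    intro b hb hb2 hvol
    have hle : ∀ α, b α ≤ 2 := fun α =>
      hb2 ▸ Finset.single_le_sum (fun β _ => (hb β).le) (Finset.mem_univ α)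
    refine ⟨⟨fun α => (hb α).le, hle⟩, hb2, fun i => ?_⟩
    have h1 := D.q_pos hb i
    have h2 := D.q_pos hb (i + 1)
    have h3 : 1 / (D.q b i * D.q b (i + 1)) ≤ W := le_trans (Finset.single_le_sum
      (f := fun i => 1 / (D.q b i * D.q b (i + 1))) (fun j _ => (one_div_pos.mpr
        (mul_pos (D.q_pos hb j) (D.q_pos hb (j + 1)))).le) (Finset.mem_univ i)) hvol
    rw [div_le_iff₀ (mul_pos h1 h2)] at h3
    rw [div_le_iff₀ (mul_pos hM hW)]
    calc 1 ≤ W * (D.q b i * D.q b (i + 1)) := h3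
      _ ≤ W * (D.q b i * M) := by gcongr; exact hqM hle _
      _ = D.q b i * (M * W) := by ring
  have hcont : ContinuousOn D.vol K := by
    unfold vol
    refine continuousOn_finsetSum _ fun i _ => ?_
    refine continuousOn_const.div
      ((D.continuous_q i).mul (D.continuous_q (i + 1))).continuousOn fun b hb => ?_
    exact (mul_pos (hKq b hb i) (hKq b hb (i + 1))).ne'
  obtain ⟨b₁, hb₁, hmin⟩ := hK.exists_isMinOn ⟨b₀, hmem b₀ hb₀ hb₀2 le_rfl⟩ hcont
  obtain ⟨r, hr, hr2, hrv⟩ := D.exists_pos_of_q_pos hb₁.2.1 (hKq b₁ hb₁)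
  refine ⟨r, D.isRCharge_iff.mpr ⟨hr, hr2, fun b hb hb2 => ?_⟩⟩
  rw [hrv]
  by_cases hvol : D.vol b ≤ W
  · exact hmin (hmem b hb hb2 hvol)
  · exact (hmin (hmem b₀ hb₀ hb₀2 le_rfl)).trans (not_le.mp hvol).le

/-! ### The charge bound at a minimiser -/

section Critical

variable {r : Fin (P.k + 3) → ℝ}

/-- The first variation of the volume at a minimiser in the direction of the ray `α₀`. -/
theorem first_variation (hr : P.IsRCharge r) (α₀ : Fin (P.k + 3)) {m : P.semigroup} (hm : m ≠ 0) :
    ∑ i, (((m : Fin 3 → ℤ) ⬝ᵥ P.ray (D.facet i) : ℤ) : ℝ) * (1 / (D.q r i * D.q r (i + 1))) *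
      ((((m : Fin 3 → ℤ) ⬝ᵥ P.ray α₀ : ℤ) : ℝ) / P.degree r m + D.pairing i α₀ / D.q r i +
        D.pairing (i + 1) α₀ / D.q r (i + 1) - 3 / 2) = 0 := by
  obtain ⟨hpos, hsum, hmin⟩ := D.isRCharge_iff.mp hr
  -- Subtracting `r / 2` keeps the total charge equal to 2.
  let b : ℝ → Fin (P.k + 3) → ℝ := fun τ α => r α + τ * ((Pi.single α₀ 1 : Fin (P.k + 3) → ℝ) α - r α / 2)
  have hb0 : b 0 = r := by ext α; simp [b]
  have hbsum : ∀ τ, ∑ α, b τ α = 2 := by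
    intro τ
    simp only [b]
    rw [Finset.sum_add_distrib, ← Finset.mul_sum, Finset.sum_sub_distrib, ← Finset.sum_div, hsum]
    simp
  have hlin : ∀ (τ : ℝ) (c : Fin (P.k + 3) → ℝ), ∑ α, b τ α * c α =
      ∑ α, r α * c α + τ * (c α₀ - (∑ α, r α * c α) / 2) := by
    intro τ c
    have h1 : c α₀ = ∑ α, (Pi.single α₀ 1 : Fin (P.k + 3) → ℝ) α * c α := by simp [Pi.single_apply]
    rw [h1, Finset.sum_div, ← Finset.sum_sub_distrib, Finset.mul_sum, ← Finset.sum_add_distrib]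
    exact Finset.sum_congr rfl fun α _ => by simp only [b]; ring
  have hbpos : ∀ᶠ τ in 𝓝 (0 : ℝ), ∀ α, 0 < b τ α := by
    rw [eventually_all]
    intro α
    have hc : ContinuousAt (fun τ => b τ α) 0 := by
      simp only [b]
      fun_prop
    refine continuousAt_const.eventually_lt hc ?_
    rw [hb0]
    exact hpos α
  have hq : ∀ i, HasDerivAt (fun τ => D.q (b τ) i) (D.pairing i α₀ - D.q r i / 2) 0 := by
    intro i
    have h1 : (fun τ => D.q (b τ) i) =
        fun τ => D.q r i + τ * (D.pairing i α₀ - D.q r i / 2) := by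
      ext τ
      exact hlin τ _
    rw [h1]
    simpa using ((hasDerivAt_id (0 : ℝ)).mul_const (D.pairing i α₀ - D.q r i / 2)).const_add
      (D.q r i)
  have hdeg : HasDerivAt (fun τ => ∑ α, b τ α * (((m : Fin 3 → ℤ) ⬝ᵥ P.ray α : ℤ) : ℝ))
      ((((m : Fin 3 → ℤ) ⬝ᵥ P.ray α₀ : ℤ) : ℝ) - P.degree r m / 2) 0 := by
    simp only [hlin, ← P.degree_apply r m]
    simpa using ((hasDerivAt_id (0 : ℝ)).mul_const
      ((((m : Fin 3 → ℤ) ⬝ᵥ P.ray α₀ : ℤ) : ℝ) - P.degree r m / 2)).const_add (P.degree r m)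
  have hqpos := D.q_pos hpos
  have hw : ∀ i, HasDerivAt (fun τ => 1 / (D.q (b τ) i * D.q (b τ) (i + 1)))
      (-(1 / (D.q r i * D.q r (i + 1)) *
        (D.pairing i α₀ / D.q r i + D.pairing (i + 1) α₀ / D.q r (i + 1) - 1))) 0 := by
    intro i
    have h1 := (hqpos i).ne'
    have h2 := (hqpos (i + 1)).ne'
    have h3 := (hasDerivAt_const (0 : ℝ) (1 : ℝ)).div ((hq i).mul (hq (i + 1)))
      (by rw [Pi.mul_apply, hb0]; exact mul_ne_zero h1 h2)
    refine h3.congr_deriv ?_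
    simp only [Pi.mul_apply, hb0]
    field_simp
    ring
  have hvol' := HasDerivAt.fun_sum fun i (_ : i ∈ Finset.univ) => hw i
  have hlocmin : IsLocalMin (fun τ => D.vol (b τ)) 0 := by
    filter_upwards [hbpos] with τ hτ
    rw [hb0]
    exact hmin _ hτ (hbsum τ)
  have hzero := hlocmin.hasDerivAt_eq_zero hvol'
  rw [hzero] at hvol'
  -- The Minkowski relation is differentiated along the path on both sides; as the volume is
  -- stationary, only the degree contributes on the left.
  have hprod := hdeg.mul hvol'
  have hp : HasDerivAt (fun τ => 2 * ∑ i, (((m : Fin 3 → ℤ) ⬝ᵥ P.ray (D.facet i) : ℤ) : ℝ) *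
      (1 / (D.q (b τ) i * D.q (b τ) (i + 1)))) _ 0 :=
    (HasDerivAt.fun_sum fun i (_ : i ∈ Finset.univ) => (hw i).const_mul
      (((m : Fin 3 → ℤ) ⬝ᵥ P.ray (D.facet i) : ℤ) : ℝ)).const_mul 2
  have hcongr : (fun τ => 2 * ∑ i, (((m : Fin 3 → ℤ) ⬝ᵥ P.ray (D.facet i) : ℤ) : ℝ) *
      (1 / (D.q (b τ) i * D.q (b τ) (i + 1)))) =ᶠ[𝓝 0]
      (fun τ => ∑ α, b τ α * (((m : Fin 3 → ℤ) ⬝ᵥ P.ray α : ℤ) : ℝ)) *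
        fun τ => ∑ i, 1 / (D.q (b τ) i * D.q (b τ) (i + 1)) := by
    filter_upwards [hbpos] with τ hτ
    exact (D.sum_mul_vol (hbsum τ) (fun i => (D.q_pos hτ i).ne') m).symm
  have heq := (hprod.congr_of_eventuallyEq hcongr).unique hp
  simp only [hb0] at heq
  have hid := D.sum_mul_vol hsum (fun i => (hqpos i).ne') m
  have hd := D.degree_pos hpos hsum hm
  change P.degree r m * D.vol r = _ at hid
  change _ * D.vol r + P.degree r m * 0 = _ at heq
  have h1 : ∀ i, (((m : Fin 3 → ℤ) ⬝ᵥ P.ray (D.facet i) : ℤ) : ℝ) *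
      (1 / (D.q r i * D.q r (i + 1))) *
      ((((m : Fin 3 → ℤ) ⬝ᵥ P.ray α₀ : ℤ) : ℝ) / P.degree r m + D.pairing i α₀ / D.q r i +
        D.pairing (i + 1) α₀ / D.q r (i + 1) - 3 / 2) =
      (((m : Fin 3 → ℤ) ⬝ᵥ P.ray (D.facet i) : ℤ) : ℝ) *
      (1 / (D.q r i * D.q r (i + 1))) *
      ((((m : Fin 3 → ℤ) ⬝ᵥ P.ray α₀ : ℤ) : ℝ) / P.degree r m - 1 / 2) -
      (((m : Fin 3 → ℤ) ⬝ᵥ P.ray (D.facet i) : ℤ) : ℝ) * -(1 / (D.q r i * D.q r (i + 1)) *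
        (D.pairing i α₀ / D.q r i + D.pairing (i + 1) α₀ / D.q r (i + 1) - 1)) := by
    intro i
    ring
  rw [Finset.sum_congr rfl fun i _ => h1 i, Finset.sum_sub_distrib, ← Finset.sum_mul]
  have h2 : ∑ i, (((m : Fin 3 → ℤ) ⬝ᵥ P.ray (D.facet i) : ℤ) : ℝ) *
      (1 / (D.q r i * D.q r (i + 1))) = P.degree r m * D.vol r / 2 := by rw [hid]; ring
  rw [h2, sub_eq_zero, eq_comm, ← mul_right_inj' (two_ne_zero (α := ℝ)), ← heq]
  field_simp
  ring

/-- In the first variation, a ratio of at least 3/2 makes every summand nonnegative, hence zero.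
Where `m` is nonzero on the facet ray, the ratio is then exactly 3/2 and both pairings with `α₀`
vanish, which identifies that facet with `α₀`. -/
theorem dotProduct_ray_le (D : BoundaryPoints P) (hr : P.IsRCharge r) (α₀ : Fin (P.k + 3)) {m : P.semigroup}
    (hm : m ≠ 0) : (((m : Fin 3 → ℤ) ⬝ᵥ P.ray α₀ : ℤ) : ℝ) ≤ 3 / 2 * P.degree r m ∧
    ((((m : Fin 3 → ℤ) ⬝ᵥ P.ray α₀ : ℤ) : ℝ) = 3 / 2 * P.degree r m ↔
      ∀ α, α ≠ α₀ → (m : Fin 3 → ℤ) ⬝ᵥ P.ray α = 0) := by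
  have key := D.first_variation hr α₀ hm
  obtain ⟨hpos, hsum, -⟩ := hr
  have hd := D.degree_pos hpos hsum hm
  have hqpos := D.q_pos hpos
  have hw : ∀ i, 0 < 1 / (D.q r i * D.q r (i + 1)) :=
    fun i => one_div_pos.mpr (mul_pos (hqpos i) (hqpos (i + 1)))
  have hρ : ∀ i, 0 ≤ (D.pairing i α₀ : ℝ) / D.q r i := fun i =>
    div_nonneg (Int.cast_nonneg (D.pairing_nonneg i α₀)) (hqpos i).le
  have hp : ∀ α, 0 ≤ (((m : Fin 3 → ℤ) ⬝ᵥ P.ray α : ℤ) : ℝ) := fun α => Int.cast_nonneg (m.2 α)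
  have hge : 3 / 2 * P.degree r m ≤ (((m : Fin 3 → ℤ) ⬝ᵥ P.ray α₀ : ℤ) : ℝ) →
      (((m : Fin 3 → ℤ) ⬝ᵥ P.ray α₀ : ℤ) : ℝ) = 3 / 2 * P.degree r m ∧
      ∀ α, α ≠ α₀ → (m : Fin 3 → ℤ) ⬝ᵥ P.ray α = 0 := by
    intro h
    rw [← le_div_iff₀ hd] at h
    have hz := (Finset.sum_eq_zero_iff_of_nonneg fun i _ => mul_nonneg
      (mul_nonneg (hp (D.facet i)) (hw i).le) (by linarith [hρ i, hρ (i + 1)])).mp key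
    have hz' : ∀ i, (m : Fin 3 → ℤ) ⬝ᵥ P.ray (D.facet i) ≠ 0 →
        (((m : Fin 3 → ℤ) ⬝ᵥ P.ray α₀ : ℤ) : ℝ) / P.degree r m = 3 / 2 ∧ α₀ = D.facet i := by
      intro i hi
      have h1 := (mul_eq_zero.mp (hz i (Finset.mem_univ i))).resolve_left
        (mul_ne_zero (Int.cast_ne_zero.mpr hi) (hw i).ne')
      have h2 := hρ i
      have h3 := hρ (i + 1)
      have h4 : ∀ j, (D.pairing j α₀ : ℝ) / D.q r j = 0 → D.pairing j α₀ = 0 := fun j hj =>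
        Int.cast_eq_zero.mp ((div_eq_zero_iff.mp hj).resolve_right (hqpos j).ne')
      have h5 := h4 i (by linarith)
      have h6 := h4 (i + 1) (by linarith)
      rw [pairing] at h5 h6
      exact ⟨by linarith, D.eq_facet i α₀ (by omega) (by omega)⟩
    have hα₀ : ∀ α, α ≠ α₀ → (m : Fin 3 → ℤ) ⬝ᵥ P.ray α = 0 := by
      intro α hα
      obtain ⟨i, rfl⟩ := D.facet_surjective α
      by_contra hne
      exact hα (hz' i hne).2.symm
    refine ⟨?_, hα₀⟩
    obtain ⟨i, hi⟩ : ∃ i, (m : Fin 3 → ℤ) ⬝ᵥ P.ray (D.facet i) ≠ 0 := by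
      by_contra! hall
      refine hd.ne' ((P.degree_apply r m).trans (Finset.sum_eq_zero fun α _ => ?_))
      obtain ⟨i, rfl⟩ := D.facet_surjective α
      rw [hall i, Int.cast_zero, mul_zero]
    have := (hz' i hi).1
    rwa [div_eq_iff hd.ne'] at this
  refine ⟨?_, fun h => (hge h.ge).2, fun h => ?_⟩
  · by_contra hlt
    exact hlt (hge (not_le.mp hlt).le).1.le
  -- Only the cones with facet `α₀` contribute, and there the pairings of `α₀` with both boundary
  -- points are zero.
  · have hsum' : ∑ i, (((m : Fin 3 → ℤ) ⬝ᵥ P.ray (D.facet i) : ℤ) : ℝ) *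
        (1 / (D.q r i * D.q r (i + 1))) *
        ((((m : Fin 3 → ℤ) ⬝ᵥ P.ray α₀ : ℤ) : ℝ) / P.degree r m - 3 / 2) = 0 := by
      rw [← key]
      refine Finset.sum_congr rfl fun i _ => ?_
      by_cases hi : D.facet i = α₀
      · have h1 : D.pairing i α₀ = 0 ∧ D.pairing (i + 1) α₀ = 0 := by
          have h2 := D.det_eq_one i
          simp only [pairing, ← hi, D.vertex_facet, det2] at h2 ⊢
          constructor <;> linarith
        rw [h1.1, h1.2]
        simp
      · rw [h _ hi]
        simp
    rw [← Finset.sum_mul] at hsum'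
    have hid := D.sum_mul_vol hsum (fun i => (hqpos i).ne') m
    have hv := D.vol_pos hpos
    change P.degree r m * D.vol r = _ at hid
    have hne : ∑ i, (((m : Fin 3 → ℤ) ⬝ᵥ P.ray (D.facet i) : ℤ) : ℝ) *
        (1 / (D.q r i * D.q r (i + 1))) ≠ 0 := by
      intro h0
      rw [h0, mul_zero] at hid
      exact (mul_pos hd hv).ne' hid
    have := (mul_eq_zero.mp hsum').resolve_left hne
    rw [sub_eq_zero, div_eq_iff hd.ne'] at this
    exact this

/-- Every generator has charge at least `4 / 3`, with equality exactly for generators pairing to `2`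
with one ray and to `0` with all others. -/
theorem four_thirds_le_charge (D : BoundaryPoints P) (hr : P.IsRCharge r) (h : P.Gen) :
    4 / 3 ≤ P.charge r h ∧ (P.charge r h = 4 / 3 ↔
      ∃ α₀, (P.genPoint h : Fin 3 → ℤ) ⬝ᵥ P.ray α₀ = 2 ∧
        ∀ α, α ≠ α₀ → (P.genPoint h : Fin 3 → ℤ) ⬝ᵥ P.ray α = 0) := by
  have hm := genPoint_ne_zero h
  have hback : (∃ α₀, (P.genPoint h : Fin 3 → ℤ) ⬝ᵥ P.ray α₀ = 2 ∧
      ∀ α, α ≠ α₀ → (P.genPoint h : Fin 3 → ℤ) ⬝ᵥ P.ray α = 0) → P.charge r h = 4 / 3 := by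
    rintro ⟨α₀, h2, h0⟩
    have h1 := (D.dotProduct_ray_le hr α₀ hm).2.mpr h0
    rw [h2] at h1
    change P.degree r (P.genPoint h) = _
    push_cast at h1
    linarith
  -- On the axis the charge is at least 2, strictly above 4/3; elsewhere a pairing of at least 2 is
  -- fed into the bound by 3/2 times the degree.
  rcases D.eq_or_exists_two_le (P.genPoint h) with ⟨h0, h1⟩ | ⟨α₀, hα₀⟩
  · have hz := D.one_le_height_genPoint h
    have hq : P.charge r h = 2 * (((P.genPoint h : Fin 3 → ℤ) 2 : ℤ) : ℝ) := by
      change P.degree r (P.genPoint h) = _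
      rw [P.degree_apply]
      simp only [P.dotProduct_ray, h0, h1]
      rw [← hr.2.1, Finset.sum_mul]
      simp
    have hz' : (1 : ℝ) ≤ (((P.genPoint h : Fin 3 → ℤ) 2 : ℤ) : ℝ) := by exact_mod_cast hz
    exact ⟨by linarith, fun h => by linarith, hback⟩
  · obtain ⟨h1, h2⟩ := D.dotProduct_ray_le hr α₀ hm
    have h3 : (2 : ℝ) ≤ (((P.genPoint h : Fin 3 → ℤ) ⬝ᵥ P.ray α₀ : ℤ) : ℝ) := by
      exact_mod_cast hα₀
    change _ ≤ 3 / 2 * P.charge r h at h1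
    change _ = 3 / 2 * P.charge r h ↔ _ at h2
    refine ⟨by linarith, fun h4 => ⟨α₀, ?_, h2.mp (by linarith)⟩, hback⟩
    have h5 : (((P.genPoint h : Fin 3 → ℤ) ⬝ᵥ P.ray α₀ : ℤ) : ℝ) ≤ 2 := by linarith
    exact le_antisymm (by exact_mod_cast h5) hα₀

/-- The difference of the two sides is `vol / (16 q) * (q - 4/3)`. -/
theorem futakiR_ge (D : BoundaryPoints P) (hr : P.IsRCharge r) (h : P.Gen) :
    FutakiDefined P.toricIdeal (P.charge r) (P.testSymmetry h) ∧
    P.futakiR r h ≥ 3 / 8 * (coeffA (P.seriesR r) 2 - coeffA (P.seriesR r) 3) ∧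
    (P.futakiR r h = 3 / 8 * (coeffA (P.seriesR r) 2 - coeffA (P.seriesR r) 3) ↔
      ∃ α₀, (P.genPoint h : Fin 3 → ℤ) ⬝ᵥ P.ray α₀ = 2 ∧
        ∀ α, α ≠ α₀ → (P.genPoint h : Fin 3 → ℤ) ⬝ᵥ P.ray α = 0) := by
  obtain ⟨h1, h2⟩ := D.four_thirds_le_charge hr h
  obtain ⟨h3, h4⟩ := D.futaki_eq hr.1 hr.2.1 h
  have h5 := (D.coeffA_hilbertSeries hr.1 hr.2.1).2.2
  have hv := D.vol_pos hr.1
  have hq := D.charge_pos hr.1 hr.2.1 h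
  have h6 : P.futakiR r h - 3 / 8 * (coeffA (P.seriesR r) 2 - coeffA (P.seriesR r) 3) =
      D.vol r / (16 * P.charge r h) * (P.charge r h - 4 / 3) := by
    rw [ReflexivePolygon.seriesR, h4, h5]
    field_simp
    ring
  have h7 : 0 < D.vol r / (16 * P.charge r h) := by positivity
  refine ⟨h3, ?_, ?_⟩
  · have := mul_nonneg h7.le (sub_nonneg.mpr h1)
    linarith
  · rw [← h2, ← sub_eq_zero, h6, mul_eq_zero, sub_eq_zero]
    exact ⟨fun h => h.resolve_left h7.ne', Or.inr⟩

end Critical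

end BoundaryPoints

/-! ### The equality case -/

namespace BoundaryPoints

variable {P : ReflexivePolygon}

theorem conclusion (D : BoundaryPoints P) {e : Prop}
    (he : (∃ h : P.Gen, ∃ α₀, (P.genPoint h : Fin 3 → ℤ) ⬝ᵥ P.ray α₀ = 2 ∧
        ∀ α, α ≠ α₀ → (P.genPoint h : Fin 3 → ℤ) ⬝ᵥ P.ray α = 0) ↔ e) :
    (∃ r, P.IsRCharge r) ∧
    ∀ r, P.IsRCharge r →
      (∀ h : P.Gen, FutakiDefined P.toricIdeal (P.charge r) (P.testSymmetry h) ∧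
        P.futakiR r h ≥ 3 / 8 * (coeffA (P.seriesR r) 2 - coeffA (P.seriesR r) 3)) ∧
      ((∃ h : P.Gen, P.futakiR r h = 3 / 8 * (coeffA (P.seriesR r) 2 - coeffA (P.seriesR r) 3)) ↔
        e) := by
  refine ⟨D.exists_isRCharge, fun r hr => ⟨fun h => ?_, ?_⟩⟩
  · exact ⟨(D.futakiR_ge hr h).1, (D.futakiR_ge hr h).2.1⟩
  · rw [← he]
    exact exists_congr fun h => (D.futakiR_ge hr h).2.2

/-- A lattice point at height one pairing to `2` with one ray and to `0` with the others. -/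
theorem exists_gen_of_point (D : BoundaryPoints P) (m : Fin 3 → ℤ) (α₀ : Fin (P.k + 3))
    (h1 : m 2 = 1) (h2 : m ⬝ᵥ P.ray α₀ = 2) (h0 : ∀ α, α ≠ α₀ → m ⬝ᵥ P.ray α = 0) :
    ∃ h : P.Gen, ∃ α₀, (P.genPoint h : Fin 3 → ℤ) ⬝ᵥ P.ray α₀ = 2 ∧
        ∀ α, α ≠ α₀ → (P.genPoint h : Fin 3 → ℤ) ⬝ᵥ P.ray α = 0 := by
  have hm : m ∈ P.semigroup := by
    intro α
    by_cases hα : α = α₀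
    · rw [hα, h2]
      decide
    · rw [h0 α hα]
  exact ⟨⟨⟨m, hm⟩, D.addIrreducible_of_height_eq_one h1⟩, α₀, h2, h0⟩

/-- No integral affine function takes the value `2` at one of the points and `0` at the others. -/
def NoApex {n : ℕ} (v : Fin n → ℤ × ℤ) : Prop :=
  ∀ x y z : ℤ, ∀ α₀, x * (v α₀).1 + y * (v α₀).2 + z = 2 →
    (∀ α, α ≠ α₀ → x * (v α).1 + y * (v α).2 + z = 0) → False

theorem not_exists_gen (H : NoApex P.vertex) :
    ¬ ∃ h : P.Gen, ∃ α₀, (P.genPoint h : Fin 3 → ℤ) ⬝ᵥ P.ray α₀ = 2 ∧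
        ∀ α, α ≠ α₀ → (P.genPoint h : Fin 3 → ℤ) ⬝ᵥ P.ray α = 0 := by
  rintro ⟨h, α₀, h2, h0⟩
  simp only [P.dotProduct_ray] at h2 h0
  exact H _ _ _ α₀ h2 h0

end BoundaryPoints

/-! ### Certificates for the sixteen polygons -/

/-- The boundary points of the polar dual of polygon 1. -/
def boundaryPoints1 : BoundaryPoints (model 1) where
  n := 0
  u := ![(1, -1), (0, 1), (-1, 0)]
  facet := ![0, 1, 2]
  weight := ![1, 1, 1]
  det_eq_one := by decide
  vertex_facet := by decide
  facet_surjective := by decide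
  eq_facet := by decide
  neg_one_le := by decide
  exists_one_le := by decide
  disjoint := by decide
  weight_pos := by decide
  rel_fst := by decide
  rel_snd := by decide

/-- The boundary points of the polar dual of polygon 2. -/
def boundaryPoints2 : BoundaryPoints (model 2) where
  n := 1
  u := ![(1, -1), (0, 1), (-1, -1), (0, -1)]
  facet := ![0, 1, 2, 2]
  weight := ![1, 3, 1, 1]
  det_eq_one := by decide
  vertex_facet := by decide
  facet_surjective := by decide
  eq_facet := by decide
  neg_one_le := by decide
  exists_one_le := by decide
  disjoint := by decide
  weight_pos := by decide
  rel_fst := by decide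
  rel_snd := by decide

/-- The boundary points of the polar dual of polygon 3. -/
def boundaryPoints3 : BoundaryPoints (model 3) where
  n := 1
  u := ![(1, 0), (0, 1), (-1, 0), (1, -1)]
  facet := ![0, 1, 2, 3]
  weight := ![1, 1, 2, 1]
  det_eq_one := by decide
  vertex_facet := by decide
  facet_surjective := by decide
  eq_facet := by decide
  neg_one_le := by decide
  exists_one_le := by decide
  disjoint := by decide
  weight_pos := by decide
  rel_fst := by decide
  rel_snd := by decide

/-- The boundary points of the polar dual of polygon 4. -/
def boundaryPoints4 : BoundaryPoints (model 4) where
  n := 1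
  u := ![(1, 0), (0, 1), (-1, 0), (0, -1)]
  facet := ![0, 1, 2, 3]
  weight := ![1, 1, 1, 1]
  det_eq_one := by decide
  vertex_facet := by decide
  facet_surjective := by decide
  eq_facet := by decide
  neg_one_le := by decide
  exists_one_le := by decide
  disjoint := by decide
  weight_pos := by decide
  rel_fst := by decide
  rel_snd := by decide

/-- The boundary points of the polar dual of polygon 5. -/
def boundaryPoints5 : BoundaryPoints (model 5) where
  n := 2
  u := ![(1, 0), (0, 1), (-1, -1), (0, -1), (1, -1)]
  facet := ![0, 1, 2, 2, 3]
  weight := ![1, 4, 2, 1, 1]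
  det_eq_one := by decide
  vertex_facet := by decide
  facet_surjective := by decide
  eq_facet := by decide
  neg_one_le := by decide
  exists_one_le := by decide
  disjoint := by decide
  weight_pos := by decide
  rel_fst := by decide
  rel_snd := by decide

/-- The boundary points of the polar dual of polygon 6. -/
def boundaryPoints6 : BoundaryPoints (model 6) where
  n := 2
  u := ![(1, 0), (0, 1), (-1, 1), (0, -1), (1, -1)]
  facet := ![0, 1, 2, 3, 4]
  weight := ![1, 1, 2, 2, 1]
  det_eq_one := by decide
  vertex_facet := by decide
  facet_surjective := by decide
  eq_facet := by decide
  neg_one_le := by decide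
  exists_one_le := by decide
  disjoint := by decide
  weight_pos := by decide
  rel_fst := by decide
  rel_snd := by decide

/-- The boundary points of the polar dual of polygon 7. -/
def boundaryPoints7 : BoundaryPoints (model 7) where
  n := 3
  u := ![(1, -1), (0, 1), (-1, 0), (-2, -1), (-1, -1), (0, -1)]
  facet := ![0, 1, 1, 2, 2, 2]
  weight := ![4, 7, 1, 1, 1, 1]
  det_eq_one := by decide
  vertex_facet := by decide
  facet_surjective := by decide
  eq_facet := by decide
  neg_one_le := by decide
  exists_one_le := by decide
  disjoint := by decide
  weight_pos := by decide
  rel_fst := by decide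
  rel_snd := by decide

/-- The boundary points of the polar dual of polygon 8. -/
def boundaryPoints8 : BoundaryPoints (model 8) where
  n := 3
  u := ![(1, 0), (1, 1), (0, 1), (-1, 1), (-1, 0), (-1, -1)]
  facet := ![0, 1, 1, 2, 2, 3]
  weight := ![4, 1, 1, 1, 1, 3]
  det_eq_one := by decide
  vertex_facet := by decide
  facet_surjective := by decide
  eq_facet := by decide
  neg_one_le := by decide
  exists_one_le := by decide
  disjoint := by decide
  weight_pos := by decide
  rel_fst := by decide
  rel_snd := by decide

/-- The boundary points of the polar dual of polygon 9. -/
def boundaryPoints9 : BoundaryPoints (model 9) where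
  n := 3
  u := ![(1, 0), (0, 1), (-1, 0), (-1, -1), (0, -1), (1, -1)]
  facet := ![0, 1, 2, 3, 3, 4]
  weight := ![1, 3, 1, 1, 1, 1]
  det_eq_one := by decide
  vertex_facet := by decide
  facet_surjective := by decide
  eq_facet := by decide
  neg_one_le := by decide
  exists_one_le := by decide
  disjoint := by decide
  weight_pos := by decide
  rel_fst := by decide
  rel_snd := by decide

/-- The boundary points of the polar dual of polygon 10. -/
def boundaryPoints10 : BoundaryPoints (model 10) where
  n := 3
  u := ![(1, 0), (0, 1), (-1, 1), (-1, 0), (0, -1), (1, -1)]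
  facet := ![0, 1, 2, 3, 4, 5]
  weight := ![1, 1, 1, 1, 1, 1]
  det_eq_one := by decide
  vertex_facet := by decide
  facet_surjective := by decide
  eq_facet := by decide
  neg_one_le := by decide
  exists_one_le := by decide
  disjoint := by decide
  weight_pos := by decide
  rel_fst := by decide
  rel_snd := by decide

/-- The boundary points of the polar dual of polygon 11. -/
def boundaryPoints11 : BoundaryPoints (model 11) where
  n := 4
  u := ![(1, 0), (0, 1), (-1, 0), (-2, -1), (-1, -1), (0, -1), (1, -1)]
  facet := ![0, 1, 1, 2, 2, 2, 3]
  weight := ![3, 4, 1, 1, 1, 1, 1]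
  det_eq_one := by decide
  vertex_facet := by decide
  facet_surjective := by decide
  eq_facet := by decide
  neg_one_le := by decide
  exists_one_le := by decide
  disjoint := by decide
  weight_pos := by decide
  rel_fst := by decide
  rel_snd := by decide

/-- The boundary points of the polar dual of polygon 12. -/
def boundaryPoints12 : BoundaryPoints (model 12) where
  n := 4
  u := ![(1, 0), (0, 1), (-1, 1), (-1, 0), (-1, -1), (0, -1), (1, -1)]
  facet := ![0, 1, 2, 2, 3, 3, 4]
  weight := ![2, 2, 1, 1, 1, 1, 1]
  det_eq_one := by decide
  vertex_facet := by decide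
  facet_surjective := by decide
  eq_facet := by decide
  neg_one_le := by decide
  exists_one_le := by decide
  disjoint := by decide
  weight_pos := by decide
  rel_fst := by decide
  rel_snd := by decide

/-- The boundary points of the polar dual of polygon 13. -/
def boundaryPoints13 : BoundaryPoints (model 13) where
  n := 5
  u := ![(1, -1), (0, 1), (-1, 3), (-1, 2), (-1, 1), (-1, 0), (-1, -1), (0, -1)]
  facet := ![0, 0, 1, 1, 1, 1, 2, 2]
  weight := ![5, 1, 1, 1, 1, 1, 1, 1]
  det_eq_one := by decide
  vertex_facet := by decide
  facet_surjective := by decide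
  eq_facet := by decide
  neg_one_le := by decide
  exists_one_le := by decide
  disjoint := by decide
  weight_pos := by decide
  rel_fst := by decide
  rel_snd := by decide

/-- The boundary points of the polar dual of polygon 14. -/
def boundaryPoints14 : BoundaryPoints (model 14) where
  n := 5
  u := ![(1, 0), (0, 1), (-1, 2), (-1, 1), (-1, 0), (-1, -1), (0, -1), (1, -1)]
  facet := ![0, 0, 1, 1, 1, 2, 2, 3]
  weight := ![2, 1, 1, 1, 1, 1, 1, 2]
  det_eq_one := by decide
  vertex_facet := by decide
  facet_surjective := by decide
  eq_facet := by decide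
  neg_one_le := by decide
  exists_one_le := by decide
  disjoint := by decide
  weight_pos := by decide
  rel_fst := by decide
  rel_snd := by decide

/-- The boundary points of the polar dual of polygon 15. -/
def boundaryPoints15 : BoundaryPoints (model 15) where
  n := 5
  u := ![(1, -1), (1, 0), (1, 1), (0, 1), (-1, 1), (-1, 0), (-1, -1), (0, -1)]
  facet := ![0, 0, 1, 1, 2, 2, 3, 3]
  weight := ![1, 1, 1, 1, 1, 1, 1, 1]
  det_eq_one := by decide
  vertex_facet := by decide
  facet_surjective := by decide
  eq_facet := by decide
  neg_one_le := by decide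
  exists_one_le := by decide
  disjoint := by decide
  weight_pos := by decide
  rel_fst := by decide
  rel_snd := by decide

/-- The boundary points of the polar dual of polygon 16. -/
def boundaryPoints16 : BoundaryPoints (model 16) where
  n := 6
  u := ![(2, -1), (1, 0), (0, 1), (-1, 2), (-1, 1), (-1, 0), (-1, -1), (0, -1), (1, -1)]
  facet := ![0, 0, 0, 1, 1, 1, 2, 2, 2]
  weight := ![1, 1, 1, 1, 1, 1, 1, 1, 1]
  det_eq_one := by decide
  vertex_facet := by decide
  facet_surjective := by decide
  eq_facet := by decide
  neg_one_le := by decide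
  exists_one_le := by decide
  disjoint := by decide
  weight_pos := by decide
  rel_fst := by decide
  rel_snd := by decide

/-! ### The case check -/

theorem mainTheorem7 (a : ℕ) (ha : a ∈ Finset.Icc 1 16) :
    (∃ r, (model a).IsRCharge r) ∧
    ∀ r, (model a).IsRCharge r →
      (∀ h : (model a).Gen,
        FutakiDefined (model a).toricIdeal ((model a).charge r) ((model a).testSymmetry h) ∧
        (model a).futakiR r h ≥
          3 / 8 * (coeffA ((model a).seriesR r) 2 - coeffA ((model a).seriesR r) 3)) ∧
      ((∃ h : (model a).Gen, (model a).futakiR r h =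
          3 / 8 * (coeffA ((model a).seriesR r) 2 - coeffA ((model a).seriesR r) 3)) ↔
        a = 2 ∨ a = 7 ∨ a = 13) := by
  rw [Finset.mem_Icc] at ha
  obtain ⟨h1, h2⟩ := ha
  interval_cases a
  -- An integral affine function vanishing on an edge of this triangle takes a multiple of 3 at the
  -- opposite vertex, never 2; likewise for polygon 16. With four or more vertices, vanishing at all
  -- but one forces it to vanish identically.
  · refine boundaryPoints1.conclusion (iff_of_false (BoundaryPoints.not_exists_gen ?_) (by decide))
    change BoundaryPoints.NoApex ![(-2, -1), (1, -1), (1, 2)]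
    intro x y z
    simp [Fin.forall_fin_succ]
    omega
  · refine boundaryPoints2.conclusion (iff_of_true ?_ (by decide))
    -- The affine function `y + 1` vanishes on the bottom edge and is 2 at the apex `(0, 1)`; it
    -- serves polygon 7 as well.
    exact boundaryPoints2.exists_gen_of_point ![0, 1, 1] 2 rfl (by decide) (by decide)
  · refine boundaryPoints3.conclusion (iff_of_false (BoundaryPoints.not_exists_gen ?_) (by decide))
    change BoundaryPoints.NoApex ![(-1, -1), (1, -1), (1, 2), (-1, 0)]
    intro x y z
    simp [Fin.forall_fin_succ]
    omega
  · refine boundaryPoints4.conclusion (iff_of_false (BoundaryPoints.not_exists_gen ?_) (by decide))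
    change BoundaryPoints.NoApex ![(-1, -1), (1, -1), (1, 1), (-1, 1)]
    intro x y z
    simp [Fin.forall_fin_succ]
    omega
  · refine boundaryPoints5.conclusion (iff_of_false (BoundaryPoints.not_exists_gen ?_) (by decide))
    change BoundaryPoints.NoApex ![(-1, -1), (2, -1), (0, 1), (-1, 0)]
    intro x y z
    simp [Fin.forall_fin_succ]
    omega
  · refine boundaryPoints6.conclusion (iff_of_false (BoundaryPoints.not_exists_gen ?_) (by decide))
    change BoundaryPoints.NoApex ![(-1, -1), (0, -1), (2, 1), (0, 1), (-1, 0)]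
    intro x y z
    simp [Fin.forall_fin_succ]
    omega
  · refine boundaryPoints7.conclusion (iff_of_true ?_ (by decide))
    exact boundaryPoints7.exists_gen_of_point ![0, 1, 1] 2 rfl (by decide) (by decide)
  · refine boundaryPoints8.conclusion (iff_of_false (BoundaryPoints.not_exists_gen ?_) (by decide))
    change BoundaryPoints.NoApex ![(-1, 0), (0, -1), (1, 0), (-1, 2)]
    intro x y z
    simp [Fin.forall_fin_succ]
    omega
  · refine boundaryPoints9.conclusion (iff_of_false (BoundaryPoints.not_exists_gen ?_) (by decide))
    change BoundaryPoints.NoApex ![(-1, -1), (1, -1), (1, 0), (0, 1), (-1, 0)]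
    intro x y z
    simp [Fin.forall_fin_succ]
    omega
  · refine boundaryPoints10.conclusion (iff_of_false (BoundaryPoints.not_exists_gen ?_) (by decide))
    change BoundaryPoints.NoApex ![(-1, -1), (0, -1), (1, 0), (1, 1), (0, 1), (-1, 0)]
    intro x y z
    simp [Fin.forall_fin_succ]
    omega
  · refine boundaryPoints11.conclusion (iff_of_false (BoundaryPoints.not_exists_gen ?_) (by decide))
    change BoundaryPoints.NoApex ![(-1, -1), (1, -1), (0, 1), (-1, 0)]
    intro x y z
    simp [Fin.forall_fin_succ]
    omega
  · refine boundaryPoints12.conclusion (iff_of_false (BoundaryPoints.not_exists_gen ?_) (by decide))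
    change BoundaryPoints.NoApex ![(-1, -1), (0, -1), (1, 0), (0, 1), (-1, 0)]
    intro x y z
    simp [Fin.forall_fin_succ]
    omega
  · refine boundaryPoints13.conclusion (iff_of_true ?_ (by decide))
    -- The affine function `x - y + 1` vanishes at `(-2, -1)` and `(0, 1)` and is 2 at `(1, 0)`.
    exact boundaryPoints13.exists_gen_of_point ![1, -1, 1] 1 rfl (by decide) (by decide)
  · refine boundaryPoints14.conclusion (iff_of_false (BoundaryPoints.not_exists_gen ?_) (by decide))
    change BoundaryPoints.NoApex ![(-1, -1), (1, 0), (0, 1), (-1, 0)]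
    intro x y z
    simp [Fin.forall_fin_succ]
    omega
  · refine boundaryPoints15.conclusion (iff_of_false (BoundaryPoints.not_exists_gen ?_) (by decide))
    change BoundaryPoints.NoApex ![(-1, 0), (0, -1), (1, 0), (0, 1)]
    intro x y z
    simp [Fin.forall_fin_succ]
    omega
  · refine boundaryPoints16.conclusion (iff_of_false (BoundaryPoints.not_exists_gen ?_) (by decide))
    change BoundaryPoints.NoApex ![(-1, -1), (1, 0), (0, 1)]
    intro x y z
    simp [Fin.forall_fin_succ]
    omega
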